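/- Let a $\mathrm{RAM}[\mathit{op}]$ be a random access machine whose registers, numbered $0,1,2,\dots$, hold non-negative integers, and whose programs are finite lists of labelled commands: an assignment of the value of an operation of $\mathit{op}$ to a register, a test of two operands for equality with a label to proceed to for each outcome, an unconditional jump, and a halt. Operands are the constants $0,1$ or the contents of explicitly named registers (there is no indirect addressing), and every command takes one unit of time. An $\mathrm{NRAM}[\mathit{op}]$ is a $\mathrm{RAM}[\mathit{op}]$ that is given, besides its input $\mathit{inp}\in\mathbb{N}$ in the first register, an arbitrary oracle-supplied integer $\alpha\in\mathbb{N}$ in the second register, all other registers being initially $0$. It recognizes a set $S\subseteq\mathbb{N}$ in $O(1)$ time if there is a constant $T$ such that the program halts after at most $T$ steps for every $\mathit{inp}$ and every $\alpha$, and, for every $\mathit{inp}$, one has $\mathit{inp}\in S$ if and only if there is an $\alpha$ for which the first register is non-zero when the program halts. Let $\leftarrow$, $\rightarrow$ and $\times$ denote left shift $a\leftarrow b=a\cdot 2^b$, right shift $a\rightarrow b=\lfloor a/2^b\rfloor$ and multiplication; let $/$ denote exact division, where $a/b$ is defined only if $b\neq 0$ and $b$ divides $a$ (a computation that evaluates an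 undefined operation does not halt); let $\mathit{inc}$ denote $a\mapsto a+1$; and let $\mathit{Bool}$ be the set of all bitwise Boolean functions of any number of operands, where the bits are computed only up to and including the most significant $1$ bit of the operands, all higher bits of the result being $0$. Theorem. Let $\mathit{op}$ be any set of operations that contains at least one of the sets $\{\leftarrow,\mathit{inc}\}\cup\mathit{Bool}$, $\{\rightarrow,\mathit{inc}\}\cup\mathit{Bool}$, $\{/,\mathit{inc}\}\cup\mathit{Bool}$, $\{\times,\mathit{inc}\}\cup\mathit{Bool}$. Then every recursively enumerable set $S\subseteq\mathbb{N}$ is recognized in $O(1)$ time by an $\mathrm{NRAM}[\mathit{op}]$. -/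

import Mathlib

namespace NRAM

/-- A basic operation of a random access machine: a number of operands and a (possibly partial)
function of that many natural numbers; `none` means that the operation is undefined there. -/
structure Operation where
  arity : ℕ
  eval : (Fin arity → ℕ) → Option ℕ

/-- Left shift, `a ← b = a * 2 ^ b`. -/
def shiftLeftOp : Operation := ⟨2, fun a => some (a 0 * 2 ^ a 1)⟩

/-- Right shift, `a → b = ⌊a / 2 ^ b⌋`. -/
def shiftRightOp : Operation := ⟨2, fun a => some (a 0 / 2 ^ a 1)⟩

/-- Exact division, defined only when the second operand is nonzero and divides the first. -/
def exactDivOp : Operation :=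
  ⟨2, fun a => if a 1 ≠ 0 ∧ a 1 ∣ a 0 then some (a 0 / a 1) else none⟩

/-- Multiplication. -/
def mulOp : Operation := ⟨2, fun a => some (a 0 * a 1)⟩

/-- Increment. -/
def incOp : Operation := ⟨1, fun a => some (a 0 + 1)⟩

/-- The bitwise application of the Boolean function `f` to `k` natural numbers. The bit positions
that are computed are those up to and including the most significant `1` bit of any of the operands;
all higher bits of the result are `0`. If `f` maps the all-`false` vector to `false`, this is bitwise
application at every position; for the one-place negation it negates the bits of the operand up to
and including its most significant `1` bit. -/
def bitwise {k : ℕ} (f : (Fin k → Bool) → Bool) (a : Fin k → ℕ) : ℕ :=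
  Nat.ofBits (n := Finset.univ.sup fun j => (a j).size) fun i => f fun j => (a j).testBit i

/-- The bitwise Boolean operation given by a Boolean function `f` of `k` arguments. -/
def boolOp {k : ℕ} (f : (Fin k → Bool) → Bool) : Operation := ⟨k, fun a => some (bitwise f a)⟩

/-- The set of all bitwise Boolean operations, of all arities. -/
def boolOps : Set Operation := {o | ∃ (k : ℕ) (f : (Fin k → Bool) → Bool), o = boolOp f}

/-- An operand: an explicit constant from `{0, 1}`, or the contents of an explicitly named register.
There is no indirect addressing. -/
inductive Operand where
  | zero : Operand
  | one : Operand
  | reg (i : ℕ) : Operand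

/-- The value of an operand, given the contents of the registers. -/
def Operand.val (r : ℕ → ℕ) : Operand → ℕ
  | .zero => 0
  | .one => 1
  | .reg i => r i

/-- The commands of a `RAM[op]`: an assignment of the value of an operation of `op` to a target
register, a test of two operands for equality with a label for either outcome, an unconditional
jump, and a halt. -/
inductive Instr (op : Set Operation) where
  | assign (o : Operation) (ho : o ∈ op) (args : Fin o.arity → Operand) (target : ℕ) : Instr op
  | ifEq (x y : Operand) (ifTrue ifFalse : ℕ) : Instr op
  | jump (label : ℕ) : Instr op
  | halt : Instr op

/-- A program is a finite list of commands; the label of a command is its position in the list,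
counted from `0`. -/
abbrev Program (op : Set Operation) := List (Instr op)

/-- A configuration: the label of the next command and the contents of all registers. -/
structure Config where
  pc : ℕ
  regs : ℕ → ℕ

/-- The effect of one command. There is no next configuration after a halt, and none when the
operation is undefined on its operands. -/
def Instr.exec {op : Set Operation} (c : Config) : Instr op → Option Config
  | .assign o _ args target =>
      (o.eval fun j => (args j).val c.regs).map fun v =>
        ⟨c.pc + 1, Function.update c.regs target v⟩
  | .ifEq x y ifTrue ifFalse =>
      some ⟨if x.val c.regs = y.val c.regs then ifTrue else ifFalse, c.regs⟩
  | .jump label => some ⟨label, c.regs⟩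
  | .halt => none

/-- One execution step; there is none if no command carries the current label. -/
def step {op : Set Operation} (P : Program op) (c : Config) : Option Config :=
  P[c.pc]?.bind fun i => i.exec c

/-- The configuration after `t` execution steps, if all of them can be made. -/
def stepN {op : Set Operation} (P : Program op) : ℕ → Config → Option Config
  | 0, c => some c
  | t + 1, c => (step P c).bind (stepN P t)

/-- The start of a computation: the first command is next, register `0` holds the input, register `1`
holds the integer supplied by the oracle, and all other registers hold `0`. -/
def init (inp α : ℕ) : Config :=
  ⟨0, fun i => if i = 0 then inp else if i = 1 then α else 0⟩

/-- On input `inp` and oracle integer `α`, the program makes exactly `t` steps and then is at a halt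
command, with output `out` in register `0`. -/
def HaltsWith {op : Set Operation} (P : Program op) (inp α t out : ℕ) : Prop :=
  ∃ c : Config, stepN P t (init inp α) = some c ∧ P[c.pc]? = some .halt ∧ c.regs 0 = out

/-- `S` is recognized by an `NRAM[op]` in time `f n`, where `n` is the bit length of the input: some
`RAM[op]` program halts after at most `f n` steps on every input with every oracle integer, and
an input is in `S` if and only if for some oracle integer the output is nonzero. -/
def RecognizesInTime (op : Set Operation) (S : Set ℕ) (f : ℕ → ℕ) : Prop :=
  ∃ P : Program op,
    (∀ inp α : ℕ, ∃ t out : ℕ, t ≤ f inp.size ∧ HaltsWith P inp α t out) ∧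
    ∀ inp : ℕ, inp ∈ S ↔ ∃ α t out : ℕ, HaltsWith P inp α t out ∧ out ≠ 0

end NRAM

/-!
A recursively enumerable set is recognized in constant time because an oracle integer can hold the
complete record of an accepting computation, and a fixed number of operations on long integers
checks the whole record at once.

*The computation.* By `Nat.Partrec'.part_iff₁`, a recursively enumerable set is the domain of a
function built from the basic functions by composition, primitive recursion and search. The graph of
such a function is tested by a nondeterministic counter program that guesses the intermediate values
(`graphTestable_of_partrec`). The control states of the program are turned into counters, too, which
results in a finite Petri net with inhibitor arcs: `n` is in the set exactly if the net can remove
all tokens, starting with `n` tokens on one place and a single token on another one (`exists_net`).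

*The record.* A computation of length `T` is a tuple of integers consisting of `T` blocks of `L`
bits. For each place there is an integer whose blocks are the successive numbers of tokens; for each
transition there is an integer that marks the blocks where it fires. That such a tuple is correct
(`Net.IsTableau`) is a conjunction of conditions of three kinds only: a condition on the bits of all
the integers at each single position, `y = 2 * x`, and `y = 2 ^ L * x`. All changes of the numbers
of tokens are checked by one addition of long integers, whose carries are a part of the tuple. The
two directions are `Net.IsTableau.reach` and `Net.exists_tableau`.

*Reading the tuple.* The oracle integer `α` has to supply the tuple and the length `L`, and a second
length, that of the blocks of `α` that hold the members of the tuple. Lengths are given by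
blocks of ones at the lower end of `α`, which are isolated as `a ^^^ (a + 1)`. Right shift and exact
division then bring the members of the tuple down to position `0`. With left shift or multiplication
this is impossible; the members are brought up to a common position `s` instead, and
the conditions are tested for the multiples by `2 ^ s`, to which they carry over (`DecodesTuples`
and the four lemmas `decodesTuples_mul`, `decodesTuples_shiftLeft`, `decodesTuples_exactDiv`,
`decodesTuples_shiftRight`). No tests and jumps are needed for all this: the terms are evaluated by
a straight-line program, whose running time is its length (`Straightline.recognizes`).
-/

namespace NRAM

/-! ### Straight-line programs -/

/-- The functions of the input and the oracle integer that are given by a term over the operations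
`op`: they are what a program without tests and jumps can compute. The condition `hF` says in
particular that no operation of the term is ever applied where it is undefined. -/
inductive Straightline (op : Set Operation) : (ℕ → ℕ → ℕ) → Prop
  | inp : Straightline op fun n _ => n
  | oracle : Straightline op fun _ α => α
  | zero : Straightline op fun _ _ => 0
  | one : Straightline op fun _ _ => 1
  | app (o : Operation) (ho : o ∈ op) (g : Fin o.arity → ℕ → ℕ → ℕ) (F : ℕ → ℕ → ℕ)
      (hg : ∀ j, Straightline op (g j))
      (hF : ∀ n α, o.eval (fun j => g j n α) = some (F n α)) : Straightline op F

theorem testBit_bitwise {k : ℕ} (f : (Fin k → Bool) → Bool) (a : Fin k → ℕ) (i : ℕ) :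
    (bitwise f a).testBit i =
      (decide (i < Finset.univ.sup fun j => (a j).size) && f fun j => (a j).testBit i) := by
  rw [bitwise, Nat.testBit_ofBits]
  split_ifs with h <;> simp [h]

theorem testBit_bitwise_of_zero {k : ℕ} {f : (Fin k → Bool) → Bool}
    (hf : f (fun _ => false) = false) (a : Fin k → ℕ) (i : ℕ) :
    (bitwise f a).testBit i = f fun j => (a j).testBit i := by
  rw [testBit_bitwise]
  by_cases h : i < Finset.univ.sup fun j => (a j).size
  · simp [h]
  · have : (fun j => (a j).testBit i) = fun _ => false := by
      funext j
      have hj : (a j).size ≤ i :=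
        (Finset.le_sup (f := fun j => (a j).size) (Finset.mem_univ j)).trans (not_lt.mp h)
      exact Nat.testBit_eq_false_of_lt (Nat.size_le.mp hj)
    simp [h, this, hf]

/-- The one-place identity as a Boolean operation: it copies its operand. -/
def copyOp : Operation := boolOp (k := 1) fun a => a 0

theorem copyOp_mem : copyOp ∈ boolOps := ⟨1, _, rfl⟩

theorem copyOp_eval (a : Fin 1 → ℕ) : copyOp.eval a = some (a 0) :=
  congrArg some (Nat.eq_of_testBit_eq fun i =>
    testBit_bitwise_of_zero (f := fun b : Fin 1 → Bool => b 0) rfl a i)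

theorem stepN_add {op : Set Operation} (P : Program op) (s t : ℕ) (c : Config) :
    stepN P (s + t) c = (stepN P s c).bind (stepN P t) := by
  induction s generalizing c with
  | zero => simp [stepN]
  | succ s ih =>
    rw [Nat.add_right_comm]
    simp only [stepN, Option.bind_assoc]
    congr 1
    funext c
    exact ih c

theorem stepN_one {op : Set Operation} (P : Program op) (c : Config) :
    stepN P 1 c = step P c := by
  simp [stepN, Option.bind_fun_some]

/-- Placed anywhere in a program, the code `C` is run through from its first to its last command,
preserves the registers below `b`, and leaves the value of `F` in register `b`. -/
def CodeFor {op : Set Operation} (C : Program op) (b : ℕ) (F : ℕ → ℕ → ℕ) : Prop :=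
  ∀ (pre post : Program op) (r : ℕ → ℕ), ∃ r' : ℕ → ℕ,
    stepN (pre ++ C ++ post) C.length ⟨pre.length, r⟩ = some ⟨pre.length + C.length, r'⟩ ∧
      (∀ i < b, r' i = r i) ∧ r' b = F (r 0) (r 1)

theorem step_assign {op : Set Operation} (pre post : Program op) (o : Operation) (ho : o ∈ op)
    (args : Fin o.arity → Operand) (t : ℕ) (r : ℕ → ℕ) (v : ℕ)
    (hv : o.eval (fun j => (args j).val r) = some v) :
    step (pre ++ [Instr.assign o ho args t] ++ post) ⟨pre.length, r⟩ =
      some ⟨pre.length + 1, Function.update r t v⟩ := by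
  simp [step, Instr.exec, hv]

theorem Straightline.exists_code {op : Set Operation} (hid : boolOps ⊆ op) {F : ℕ → ℕ → ℕ}
    (hF : Straightline op F) : ∀ b, 2 ≤ b → ∃ C : Program op, CodeFor C b F := by
  have copy : ∀ (x : Operand) (G : ℕ → ℕ → ℕ) (b : ℕ), (∀ r, x.val r = G (r 0) (r 1)) →
      2 ≤ b → ∃ C : Program op, CodeFor C b G := by
    intro x G b hx hb
    refine ⟨[Instr.assign copyOp (hid copyOp_mem) (fun _ => x) b], ?_⟩
    intro pre post r
    refine ⟨Function.update r b (x.val r), ?_, ?_, ?_⟩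
    · rw [List.length_singleton, stepN_one]
      exact step_assign _ _ _ _ _ _ _ _ (copyOp_eval _)
    · intro i hi
      exact Function.update_of_ne hi.ne _ _
    · simp [hx]
  induction hF with
  | inp => exact fun b => copy (.reg 0) _ b fun r => rfl
  | oracle => exact fun b => copy (.reg 1) _ b fun r => rfl
  | zero => exact fun b => copy .zero _ b fun r => rfl
  | one => exact fun b => copy .one _ b fun r => rfl
  | app o ho g F hg hF ih =>
    intro b hb
    -- The first `m` operands are evaluated into the registers `b, …, b + m - 1`.
    have args : ∀ m ≤ o.arity, ∃ C : Program op, ∀ (pre post : Program op) (r : ℕ → ℕ),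
        ∃ r' : ℕ → ℕ,
          stepN (pre ++ C ++ post) C.length ⟨pre.length, r⟩ =
            some ⟨pre.length + C.length, r'⟩ ∧
          (∀ i < b, r' i = r i) ∧
          ∀ j : Fin o.arity, (j : ℕ) < m → r' (b + j) = g j (r 0) (r 1) := by
      intro m
      induction m with
      | zero =>
        intro _
        exact ⟨[], fun pre post r => ⟨r, by simp [stepN], by simp, by simp⟩⟩
      | succ m ihm =>
        intro hm
        obtain ⟨C, hC⟩ := ihm (by omega)
        obtain ⟨D, hD⟩ := ih ⟨m, hm⟩ (b + m) (by omega)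
        refine ⟨C ++ D, fun pre post r => ?_⟩
        obtain ⟨r₁, h₁, h₁', h₁''⟩ := hC pre (D ++ post) r
        obtain ⟨r₂, h₂, h₂', h₂''⟩ := hD (pre ++ C) post r₁
        refine ⟨r₂, ?_, fun i hi => ?_, fun j hj => ?_⟩
        · simp only [List.length_append, List.append_assoc] at h₁ h₂ ⊢
          rw [stepN_add, h₁, Option.bind_some, h₂, Nat.add_assoc]
        · rw [h₂' i (by omega), h₁' i hi]
        · rcases Nat.lt_succ_iff_lt_or_eq.mp hj with hj | hj
          · rw [h₂' _ (by omega), h₁'' j hj]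
          · have : j = ⟨m, hm⟩ := Fin.ext hj
            subst this
            simp only
            rw [h₂'', h₁' 0 (by omega), h₁' 1 (by omega)]
    obtain ⟨C, hC⟩ := args o.arity le_rfl
    refine ⟨C ++ [Instr.assign o ho (fun j => .reg (b + j)) b], fun pre post r => ?_⟩
    obtain ⟨r₁, h₁, h₁', h₁''⟩ :=
      hC pre ([Instr.assign o ho (fun j => .reg (b + j)) b] ++ post) r
    have hs := step_assign (pre ++ C) post o ho (fun j => .reg (b + j)) b r₁ (F (r 0) (r 1)) (by
      rw [← hF]
      congr 1
      funext j
      exact h₁'' j j.2)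
    refine ⟨Function.update r₁ b (F (r 0) (r 1)), ?_, fun i hi => ?_, by simp⟩
    · simp only [List.length_append, List.append_assoc, List.length_singleton] at h₁ hs ⊢
      rw [stepN_add, h₁, Option.bind_some, stepN_one, hs, Nat.add_assoc]
    · rw [Function.update_of_ne hi.ne, h₁' i hi]

/-- A program reaches a halt command in at most one way. -/
theorem stepN_halt {op : Set Operation} {P : Program op} {s t : ℕ} {c d e : Config}
    (hs : stepN P s c = some d) (hd : P[d.pc]? = some .halt)
    (ht : stepN P t c = some e) (he : P[e.pc]? = some .halt) : d = e := by
  have stuck : ∀ (c : Config), P[c.pc]? = some .halt → ∀ k, stepN P (k + 1) c = none := by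
    intro c hc k
    simp [stepN, step, hc, Instr.exec]
  rcases lt_trichotomy s t with h | h | h
  · obtain ⟨k, rfl⟩ := Nat.exists_eq_add_of_lt h
    rw [Nat.add_assoc, stepN_add, hs, Option.bind_some, stuck d hd] at ht
    cases ht
  · subst h
    rw [hs] at ht
    exact Option.some.inj ht
  · obtain ⟨k, rfl⟩ := Nat.exists_eq_add_of_lt h
    rw [Nat.add_assoc, stepN_add, ht, Option.bind_some, stuck e he] at hs
    cases hs

/-- Copying the value of `F` from register `2` to register `0` by one more assignment, a
straight-line program recognizes the set of inputs for which `F` has a nonzero value. -/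
theorem Straightline.recognizes {op : Set Operation} (hid : boolOps ⊆ op) {F : ℕ → ℕ → ℕ}
    (hF : Straightline op F) {S : Set ℕ} (hS : ∀ n, n ∈ S ↔ ∃ α, F n α ≠ 0) :
    ∃ T : ℕ, RecognizesInTime op S (fun _ => T) := by
  obtain ⟨C, hC⟩ := hF.exists_code hid 2 le_rfl
  let I : Instr op := .assign copyOp (hid copyOp_mem) (fun _ => .reg 2) 0
  let P : Program op := C ++ [I] ++ [Instr.halt]
  have key : ∀ n α, HaltsWith P n α (C.length + 1) (F n α) := by
    intro n α
    obtain ⟨r, h₁, -, h₃⟩ := hC [] ([I] ++ [Instr.halt]) (init n α).regs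
    refine ⟨⟨C.length + 1, Function.update r 0 (r 2)⟩, ?_, ?_, ?_⟩
    · have hs := step_assign C [Instr.halt] copyOp (hid copyOp_mem) (fun _ => .reg 2) 0 r (r 2)
        (copyOp_eval _)
      have h₁' : stepN P C.length (init n α) = some ⟨C.length, r⟩ := by
        simpa [P, init, I] using h₁
      rw [stepN_add, h₁', Option.bind_some, stepN_one]
      exact hs
    · simp [P]
    · simp [h₃, init]
  refine ⟨C.length + 1, P, fun n α => ⟨_, _, le_rfl, key n α⟩, fun n => ?_⟩
  rw [hS]
  constructor
  · rintro ⟨α, hα⟩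
    exact ⟨α, _, _, key n α, hα⟩
  · rintro ⟨α, t, out, ⟨c, hc, hh, rfl⟩, hout⟩
    obtain ⟨d, hd, hdh, hd'⟩ := key n α
    rw [stepN_halt hc hh hd hdh, hd'] at hout
    exact ⟨α, hout⟩

section

variable {op : Set Operation}

/-! ### Bitwise terms and straight-line tests -/

theorem Straightline.bitwise (hb : boolOps ⊆ op) {k : ℕ} (f : (Fin k → Bool) → Bool)
    {g : Fin k → ℕ → ℕ → ℕ} (hg : ∀ j, Straightline op (g j)) :
    Straightline op fun n α => NRAM.bitwise f fun j => g j n α :=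
  .app (boolOp f) (hb ⟨k, f, rfl⟩) g _ hg fun _ _ => rfl

theorem Straightline.binary (hb : boolOps ⊆ op) {G : ℕ → ℕ → ℕ} (f : Bool → Bool → Bool)
    (hf : f false false = false) (hG : ∀ a b i, (G a b).testBit i = f (a.testBit i) (b.testBit i))
    {A B : ℕ → ℕ → ℕ} (hA : Straightline op A) (hB : Straightline op B) :
    Straightline op fun n α => G (A n α) (B n α) := by
  have h := Straightline.bitwise hb (fun b : Fin 2 → Bool => f (b 0) (b 1)) (g := ![A, B])
    (by intro j; fin_cases j <;> assumption)
  convert h using 3 with n α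
  apply Nat.eq_of_testBit_eq
  intro i
  rw [hG, testBit_bitwise_of_zero (by exact hf)]
  rfl

theorem Straightline.and (hb : boolOps ⊆ op) {A B : ℕ → ℕ → ℕ} (hA : Straightline op A)
    (hB : Straightline op B) : Straightline op fun n α => A n α &&& B n α :=
  .binary hb (· && ·) rfl (fun _ _ _ => Nat.testBit_and ..) hA hB

theorem Straightline.or (hb : boolOps ⊆ op) {A B : ℕ → ℕ → ℕ} (hA : Straightline op A)
    (hB : Straightline op B) : Straightline op fun n α => A n α ||| B n α :=
  .binary hb (· || ·) rfl (fun _ _ _ => Nat.testBit_or ..) hA hB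

theorem Straightline.xor (hb : boolOps ⊆ op) {A B : ℕ → ℕ → ℕ} (hA : Straightline op A)
    (hB : Straightline op B) : Straightline op fun n α => A n α ^^^ B n α :=
  .binary hb Bool.xor rfl (fun _ _ _ => Nat.testBit_xor ..) hA hB

theorem Straightline.ldiff (hb : boolOps ⊆ op) {A B : ℕ → ℕ → ℕ} (hA : Straightline op A)
    (hB : Straightline op B) : Straightline op fun n α => Nat.ldiff (A n α) (B n α) :=
  .binary hb (fun a b => a && !b) rfl (fun _ _ _ => Nat.testBit_ldiff ..) hA hB

/-- The truncation of the bitwise operations at the most significant bit makes the size of a number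
accessible: the constant `true` yields a block of ones of that size. -/
theorem Straightline.ones (hb : boolOps ⊆ op) {A : ℕ → ℕ → ℕ} (hA : Straightline op A) :
    Straightline op fun n α => 2 ^ (A n α).size - 1 := by
  have h := Straightline.bitwise hb (fun _ : Fin 1 → Bool => true) (g := fun _ => A) fun _ => hA
  convert h using 3 with n α
  apply Nat.eq_of_testBit_eq
  intro i
  rw [Nat.testBit_two_pow_sub_one, testBit_bitwise]
  simp

theorem Straightline.succ (hi : incOp ∈ op) {A : ℕ → ℕ → ℕ} (hA : Straightline op A) :
    Straightline op fun n α => A n α + 1 :=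
  .app incOp hi (fun _ => A) _ (fun _ => hA) fun _ _ => rfl

/-- `φ` holds of an input and an oracle integer exactly if some term over `op`, an error indicator,
is zero. -/
def StraightlineTest (op : Set Operation) (φ : ℕ → ℕ → Prop) : Prop :=
  ∃ e, Straightline op e ∧ ∀ n α, φ n α ↔ e n α = 0

theorem StraightlineTest.congr {φ ψ : ℕ → ℕ → Prop} (h : StraightlineTest op φ)
    (hφ : ∀ n α, ψ n α ↔ φ n α) : StraightlineTest op ψ := by
  obtain ⟨e, he, h⟩ := h
  exact ⟨e, he, fun n α => (hφ n α).trans (h n α)⟩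

theorem StraightlineTest.eq (hb : boolOps ⊆ op) {A B : ℕ → ℕ → ℕ} (hA : Straightline op A)
    (hB : Straightline op B) : StraightlineTest op fun n α => A n α = B n α :=
  ⟨_, hA.xor hb hB, fun _ _ => Nat.xor_eq_zero_iff.symm⟩

/-- A condition `B` on the bits at each single position is tested by a single bitwise operation. It
has to hold for zero bits, as it is only tested up to the most significant bit. -/
theorem StraightlineTest.bits (hb : boolOps ⊆ op) {ι : Type*} [Finite ι] {B : (ι → Bool) → Prop}
    (hB : B fun _ => false) {w : ι → ℕ → ℕ → ℕ} (hw : ∀ j, Straightline op (w j)) :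
    StraightlineTest op fun n α => ∀ i, B fun j => (w j n α).testBit i := by
  classical
  obtain ⟨k, ⟨σ⟩⟩ := Finite.exists_equiv_fin ι
  let f : (Fin k → Bool) → Bool := fun b => !decide (B fun j => b (σ j))
  have hf : f (fun _ => false) = false := by simpa [f] using hB
  refine ⟨_, Straightline.bitwise hb f fun j => hw (σ.symm j), fun n α => ?_⟩
  constructor
  · intro h
    apply Nat.eq_of_testBit_eq
    intro i
    rw [testBit_bitwise_of_zero hf]
    simpa [f] using h i
  · intro h i
    have := testBit_bitwise_of_zero hf (fun j => w (σ.symm j) n α) i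
    rw [h] at this
    simpa [f] using this

theorem StraightlineTest.forall (hb : boolOps ⊆ op) {ι : Type*} [Finite ι]
    {φ : ι → ℕ → ℕ → Prop} (h : ∀ j, StraightlineTest op (φ j)) :
    StraightlineTest op fun n α => ∀ j, φ j n α := by
  choose e he h using h
  refine (StraightlineTest.bits hb (B := fun b : ι → Bool => ∀ j, b j = false) (fun _ => rfl)
    he).congr fun n α => ?_
  simp only [h]
  exact ⟨fun h i j => by simp [h j], fun h j => Nat.eq_of_testBit_eq fun i => by simp [h i j]⟩

theorem StraightlineTest.and (hb : boolOps ⊆ op) {φ ψ : ℕ → ℕ → Prop}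
    (hφ : StraightlineTest op φ) (hψ : StraightlineTest op ψ) :
    StraightlineTest op fun n α => φ n α ∧ ψ n α :=
  (StraightlineTest.forall hb (φ := fun b : Bool => if b then φ else ψ)
    (by intro b; cases b <;> simpa)).congr fun n α => by simp [and_comm]

/-- The error indicator `e` is turned into an output by `2 ^ e.size &&& 1`, which is nonzero exactly
if `e = 0`. -/
theorem StraightlineTest.recognizes (hb : boolOps ⊆ op) (hi : incOp ∈ op) {φ : ℕ → ℕ → Prop}
    (hφ : StraightlineTest op φ) {S : Set ℕ} (hS : ∀ n, n ∈ S ↔ ∃ α, φ n α) :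
    ∃ T : ℕ, RecognizesInTime op S (fun _ => T) := by
  obtain ⟨e, he, h⟩ := hφ
  refine (((he.ones hb).succ hi).and hb .one).recognizes hb fun n => ?_
  rw [hS]
  refine exists_congr fun α => ?_
  rw [h, Nat.sub_add_cancel Nat.one_le_two_pow, Nat.and_one_is_mod]
  rcases Nat.eq_zero_or_pos (e n α) with h0 | h0
  · simp [h0]
  · obtain ⟨k, hk⟩ := Nat.exists_eq_succ_of_ne_zero (Nat.size_pos.mpr h0).ne'
    simp [hk, h0.ne', Nat.pow_succ]

/-! ### Reading lengths off an integer -/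

/-- The block of ones reaching up to and including the lowest zero bit of `a`. -/
def low (a : ℕ) : ℕ := a ^^^ (a + 1)

theorem low_two_pow_mul_add (k q : ℕ) : low (2 ^ (k + 1) * q + (2 ^ k - 1)) = 2 ^ (k + 1) - 1 := by
  have h1 : 2 ^ (k + 1) * q + (2 ^ k - 1) = 2 ^ k * (2 * q) + (2 ^ k - 1) := by ring
  have hk := Nat.one_le_two_pow (n := k)
  have h2 : 2 ^ (k + 1) * q + (2 ^ k - 1) + 1 = 2 ^ k * (2 * q + 1) + 0 := by
    rw [Nat.add_assoc, Nat.sub_add_cancel hk]; ring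
  rw [low, h2, h1]
  apply Nat.eq_of_testBit_eq
  intro i
  rw [Nat.testBit_xor, Nat.testBit_two_pow_mul_add _ (by omega),
    Nat.testBit_two_pow_mul_add _ (by omega), Nat.testBit_two_pow_sub_one]
  by_cases hik : i < k
  · simp [hik, Nat.testBit_two_pow_sub_one]; omega
  · simp only [hik, if_false]
    rcases Nat.eq_or_lt_of_le (not_lt.mp hik) with rfl | h
    · simp
    · obtain ⟨d, rfl⟩ := Nat.exists_eq_add_of_lt h
      have : k + d + 1 - k = d + 1 := by omega
      rw [this, Nat.testBit_succ, Nat.testBit_succ]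
      have e1 : 2 * q / 2 = q := by omega
      have e2 : (2 * q + 1) / 2 = q := by omega
      simp [e1, e2]

theorem exists_low_eq (a : ℕ) : ∃ k, low a = 2 ^ (k + 1) - 1 := by
  suffices h : ∃ k q, a = 2 ^ (k + 1) * q + (2 ^ k - 1) by
    obtain ⟨k, q, rfl⟩ := h
    exact ⟨k, low_two_pow_mul_add k q⟩
  induction a using Nat.strong_induction_on with
  | _ a ih =>
    rcases Nat.even_or_odd' a with ⟨m, rfl | rfl⟩
    · exact ⟨0, m, by simp⟩
    · obtain ⟨k, q, h⟩ := ih m (by omega)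
      refine ⟨k + 1, q, ?_⟩
      have hk := Nat.one_le_two_pow (n := k)
      have : 2 ^ (k + 1) - 1 = 2 * (2 ^ k - 1) + 1 := by rw [Nat.pow_succ]; omega
      rw [this]
      nth_rw 1 [h]
      ring

/-- A second block of ones, found in the same way after the lowest zero bit has been set. -/
def low₂ (a : ℕ) : ℕ := low (a ||| low a)

/-- Two lengths can be prescribed independently by a header `h` at the lower end of an integer: `h`
consists of `k₁` ones, a zero, `k₂` ones, and another zero. -/
theorem exists_header (k₁ k₂ : ℕ) : ∃ h < 2 ^ (k₁ + k₂ + 2), ∀ q,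
    low (2 ^ (k₁ + k₂ + 2) * q + h) = 2 ^ (k₁ + 1) - 1 ∧
      low₂ (2 ^ (k₁ + k₂ + 2) * q + h) = 2 ^ (k₁ + k₂ + 2) - 1 := by
  have h1 := Nat.one_le_two_pow (n := k₁)
  have h2 := Nat.one_le_two_pow (n := k₂)
  have e1 : 2 ^ (k₁ + 1) = 2 * 2 ^ k₁ := by ring
  have e2 : 2 ^ (k₁ + k₂ + 1) = 2 ^ (k₁ + 1) * 2 ^ k₂ := by ring
  have e3 : 2 ^ (k₁ + k₂ + 2) = 2 * 2 ^ (k₁ + k₂ + 1) := by ring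
  have e4 : 2 ^ (k₁ + 1) * (2 ^ k₂ - 1) + 2 ^ (k₁ + 1) = 2 ^ (k₁ + k₂ + 1) := by
    rw [e2, Nat.mul_sub, mul_one, Nat.sub_add_cancel]
    exact Nat.le_mul_of_pos_right _ h2
  refine ⟨2 ^ (k₁ + 1) * (2 ^ k₂ - 1) + (2 ^ k₁ - 1), by omega, fun q => ?_⟩
  have e5 : 2 ^ (k₁ + k₂ + 2) * q + (2 ^ (k₁ + 1) * (2 ^ k₂ - 1) + (2 ^ k₁ - 1)) =
      2 ^ (k₁ + 1) * (2 ^ (k₂ + 1) * q + (2 ^ k₂ - 1)) + (2 ^ k₁ - 1) := by ring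
  have hlow := low_two_pow_mul_add k₁ (2 ^ (k₂ + 1) * q + (2 ^ k₂ - 1))
  rw [low₂, e5, hlow]
  refine ⟨rfl, ?_⟩
  have e6 : 2 ^ (k₁ + 1) * (2 ^ (k₂ + 1) * q + (2 ^ k₂ - 1)) + (2 ^ k₁ - 1) |||
      2 ^ (k₁ + 1) - 1 = 2 ^ (k₁ + k₂ + 1 + 1) * q + (2 ^ (k₁ + k₂ + 1) - 1) := by
    have : 2 ^ (k₁ + k₂ + 1 + 1) * q + (2 ^ (k₁ + k₂ + 1) - 1) =
        2 ^ (k₁ + 1) * (2 ^ (k₂ + 1) * q + (2 ^ k₂ - 1)) + (2 ^ (k₁ + 1) - 1) := by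
      have : 2 ^ (k₁ + k₂ + 1 + 1) * q = 2 ^ (k₁ + 1) * (2 ^ (k₂ + 1) * q) := by ring
      rw [this, Nat.mul_add]
      omega
    rw [this]
    apply Nat.eq_of_testBit_eq
    intro i
    rw [Nat.testBit_or, Nat.testBit_two_pow_mul_add _ (by omega),
      Nat.testBit_two_pow_mul_add (b := 2 ^ (k₁ + 1) - 1) _ (by omega),
      Nat.testBit_two_pow_sub_one]
    by_cases hi : i < k₁ + 1 <;> simp only [hi, if_true, if_false] <;> simp <;> omega
  rw [e6, low_two_pow_mul_add]

theorem size_two_pow_sub_one (k : ℕ) : (2 ^ k - 1).size = k := by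
  have := Nat.one_le_two_pow (n := k)
  apply le_antisymm
  · exact Nat.size_le.mpr (by omega)
  · rcases k with _ | k
    · simp
    · refine Nat.lt_size.mpr ?_
      have := Nat.one_le_two_pow (n := k)
      rw [Nat.pow_succ]; omega

theorem Straightline.low (hb : boolOps ⊆ op) (hi : incOp ∈ op) {A : ℕ → ℕ → ℕ}
    (hA : Straightline op A) : Straightline op fun n α => NRAM.low (A n α) :=
  hA.xor hb (hA.succ hi)

theorem Straightline.low₂ (hb : boolOps ⊆ op) (hi : incOp ∈ op) {A : ℕ → ℕ → ℕ}
    (hA : Straightline op A) : Straightline op fun n α => NRAM.low₂ (A n α) :=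
  (hA.or hb (hA.low hb hi)).low hb hi

/-! ### Decoding a tuple of integers from the oracle integer -/

/-- With the operations `op`, an oracle integer `α` can stand for a length `L α` and `N` numbers:
straight-line terms `w j` read off `2 ^ s α * v j` for arbitrary numbers `v j`, and there are
straight-line tests for doubling and for multiplication by `2 ^ L α` among these terms. The scale
`2 ^ s α` is there because left shifts and multiplications cannot move the higher bits of `α` down.
The test for multiplication also verifies `ok α`, the well-formedness of what else `α` contains. -/
def DecodesTuples (op : Set Operation) : Prop :=
  ∀ N : ℕ, ∃ (s L : ℕ → ℕ) (w : ℕ → ℕ → ℕ) (ok : ℕ → Prop),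
    (Straightline op fun n α => 2 ^ s α * n) ∧ (Straightline op fun _ α => 2 ^ s α) ∧
    (∀ j, Straightline op fun _ α => w j α) ∧
    (∀ i j, StraightlineTest op fun _ α => w j α = 2 * w i α) ∧
    (∀ i j, StraightlineTest op fun _ α => ok α ∧ w j α = 2 ^ L α * w i α) ∧
    (∀ α, 1 ≤ L α) ∧ (∀ α, ∀ j < N, 2 ^ s α ∣ w j α) ∧
    ∀ l₀, ∃ l ≥ l₀, ∀ v : ℕ → ℕ, ∃ α, ok α ∧ L α = l ∧ ∀ j < N, w j α = 2 ^ s α * v j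

/-- Numbers below `2 ^ b` are packed as the digits in base `2 ^ b` of a single one. -/
theorem exists_pack (N : ℕ) (v : ℕ → ℕ) (b : ℕ) (hv : ∀ j < N, v j < 2 ^ b) :
    ∃ q, ∀ j < N, q / (2 ^ b) ^ j % 2 ^ b = v j := by
  induction N generalizing v with
  | zero => exact ⟨0, by simp⟩
  | succ N ih =>
    obtain ⟨q, hq⟩ := ih (fun j => v (j + 1)) fun j hj => hv _ (by omega)
    have h0 := hv 0 (by omega)
    refine ⟨v 0 + 2 ^ b * q, fun j hj => ?_⟩
    rcases j with _ | j
    · simp [Nat.mod_eq_of_lt h0]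
    · rw [pow_succ', ← Nat.div_div_eq_div_mul, Nat.add_mul_div_left _ _ (by positivity),
        Nat.div_eq_of_lt h0, zero_add]
      exact hq j (by omega)

theorem exists_bound (N : ℕ) (v : ℕ → ℕ) : ∃ m, ∀ b ≥ m, ∀ j < N, v j < 2 ^ b := by
  refine ⟨∑ j ∈ Finset.range N, v j, fun b hb j hj => ?_⟩
  have := Finset.single_le_sum (f := v) (fun _ _ => Nat.zero_le _) (Finset.mem_range.mpr hj)
  exact lt_of_lt_of_le (Nat.lt_two_pow_self) (Nat.pow_le_pow_right (by norm_num) (this.trans hb))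

theorem and_mask_mul (a b k : ℕ) :
    a &&& (2 ^ b - 1) * 2 ^ k = a / 2 ^ k % 2 ^ b * 2 ^ k := by
  apply Nat.eq_of_testBit_eq
  intro i
  rw [Nat.testBit_and, Nat.testBit_mul_two_pow, Nat.testBit_mul_two_pow, Nat.testBit_mod_two_pow,
    Nat.testBit_div_two_pow, Nat.testBit_two_pow_sub_one]
  by_cases h : k ≤ i
  · simp [h, Bool.and_comm]
  · simp [h]

/-- Decoding with operations that move bits up: block `j + 1` of `α` is masked out and moved up to
the common position `b * N`. -/
theorem decodesTuples_of_up (hb : boolOps ⊆ op) (b L : ℕ → ℕ)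
    (hmask : Straightline op fun _ α => 2 ^ b α - 1)
    (hmul : ∀ F, Straightline op F → Straightline op fun n α => F n α * 2 ^ b α)
    (htwo : ∀ F, Straightline op F → Straightline op fun n α => 2 * F n α)
    (hshift : ∀ F, Straightline op F → Straightline op fun n α => 2 ^ L α * F n α)
    (hL : ∀ α, 1 ≤ L α)
    (hcode : ∀ l₀, ∃ l ≥ l₀, ∀ m, ∃ c ≥ m, ∃ h < 2 ^ c, ∀ q,
      L (2 ^ c * q + h) = l ∧ b (2 ^ c * q + h) = c) :
    DecodesTuples op := by
  intro N
  have hmuls : ∀ k F, Straightline op F →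
      Straightline op fun n α => F n α * (2 ^ b α) ^ k := by
    intro k F hF
    induction k with
    | zero => simpa using hF
    | succ k ih => simpa only [pow_succ, mul_assoc] using hmul _ ih
  have hw : ∀ j, Straightline op fun _ α =>
      (α &&& (2 ^ b α - 1) * (2 ^ b α) ^ (j + 1)) * (2 ^ b α) ^ (N - 1 - j) :=
    fun j => hmuls _ _ (.and hb .oracle (hmuls _ _ hmask))
  have hval : ∀ α, ∀ j < N, (α &&& (2 ^ b α - 1) * (2 ^ b α) ^ (j + 1)) * (2 ^ b α) ^ (N - 1 - j) =
      2 ^ (b α * N) * (α / 2 ^ b α / (2 ^ b α) ^ j % 2 ^ b α) := by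
    intro α j hj
    have e : (2 ^ b α) ^ (j + 1) = 2 ^ (b α * (j + 1)) := (pow_mul _ _ _).symm
    rw [e, and_mask_mul, ← e, mul_assoc, ← pow_add, Nat.div_div_eq_div_mul, ← pow_succ', pow_mul,
      mul_comm]
    congr 2
    omega
  refine ⟨fun α => b α * N, L, _, fun _ => True, ?_, ?_, hw,
    fun i j => .eq hb (hw j) (htwo _ (hw i)),
    fun i j => (StraightlineTest.eq hb (hw j) (hshift _ (hw i))).congr fun n α => by simp,
    hL, ?_, ?_⟩
  · convert hmuls N _ .inp using 3
    rw [pow_mul, mul_comm]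
  · simpa only [pow_mul, one_mul] using hmuls N _ .one
  · intro α j hj
    rw [hval α j hj]
    exact Dvd.intro _ rfl
  · intro l₀
    obtain ⟨l, hl, h⟩ := hcode l₀
    refine ⟨l, hl, fun v => ?_⟩
    obtain ⟨m, hm⟩ := exists_bound N v
    obtain ⟨c, hc, r, hr, h⟩ := h m
    obtain ⟨q, hq⟩ := exists_pack N v c (hm c hc)
    refine ⟨2 ^ c * q + r, trivial, (h q).1, fun j hj => ?_⟩
    refine (hval _ j hj).trans ?_
    simp only [(h q).2]
    congr 1
    rw [Nat.mul_add_div (by positivity), Nat.div_eq_of_lt hr, add_zero]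
    exact hq j hj

/-- Decoding with operations that move bits down: block `d + j` of `α` is moved down to position
`0` and masked. -/
theorem decodesTuples_of_down (hb : boolOps ⊆ op) (b L M : ℕ → ℕ) (ok : ℕ → Prop) (d : ℕ)
    (hmask : Straightline op fun _ α => M α)
    (hdiv : ∀ F, Straightline op F → Straightline op fun n α => F n α / 2 ^ b α)
    (htwo : ∀ F G, Straightline op F → Straightline op G →
      StraightlineTest op fun n α => G n α = 2 * F n α)
    (hshift : ∀ F G, Straightline op F → Straightline op G →
      StraightlineTest op fun n α => ok α ∧ G n α = 2 ^ L α * F n α)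
    (hL : ∀ α, 1 ≤ L α)
    (hcode : ∀ l₀, ∃ l ≥ l₀, ∀ m, ∃ c ≥ m, ∃ h < (2 ^ c) ^ d, ∀ q,
      L ((2 ^ c) ^ d * q + h) = l ∧ b ((2 ^ c) ^ d * q + h) = c ∧
        M ((2 ^ c) ^ d * q + h) = 2 ^ c - 1 ∧ ok ((2 ^ c) ^ d * q + h)) :
    DecodesTuples op := by
  intro N
  have hdivs : ∀ k F, Straightline op F →
      Straightline op fun n α => F n α / (2 ^ b α) ^ k := by
    intro k F hF
    induction k with
    | zero => simpa using hF
    | succ k ih => simpa only [pow_succ, ← Nat.div_div_eq_div_mul] using hdiv _ ih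
  have hw : ∀ j, Straightline op fun _ α => α / (2 ^ b α) ^ d / (2 ^ b α) ^ j &&& M α :=
    fun j => .and hb (hdivs _ _ (hdivs _ _ .oracle)) hmask
  refine ⟨fun α => 0, L, _, ok, ?_, ?_, hw, fun i j => htwo _ _ (hw i) (hw j),
    fun i j => hshift _ _ (hw i) (hw j), hL, by simp, ?_⟩
  · simpa using .inp
  · simpa using .one
  · intro l₀
    obtain ⟨l, hl, h⟩ := hcode l₀
    refine ⟨l, hl, fun v => ?_⟩
    obtain ⟨m, hm⟩ := exists_bound N v
    obtain ⟨c, hc, r, hr, h⟩ := h m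
    obtain ⟨q, hq⟩ := exists_pack N v c (hm c hc)
    obtain ⟨h1, h2, h3, h4⟩ := h q
    refine ⟨(2 ^ c) ^ d * q + r, h4, h1, fun j hj => ?_⟩
    rw [h2, h3, Nat.and_two_pow_sub_one_eq_mod, pow_zero, one_mul,
      Nat.mul_add_div (by positivity), Nat.div_eq_of_lt hr, add_zero]
    exact hq j hj

theorem one_le_size_low (a : ℕ) : 1 ≤ (low a).size := by
  obtain ⟨k, hk⟩ := exists_low_eq a
  rw [hk, size_two_pow_sub_one]
  omega

theorem one_le_low (a : ℕ) : 1 ≤ low a := Nat.size_pos.mp (one_le_size_low a)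

theorem two_pow_size_low (a : ℕ) : 2 ^ (low a).size = low a + 1 := by
  obtain ⟨k, hk⟩ := exists_low_eq a
  rw [hk, size_two_pow_sub_one, Nat.sub_add_cancel Nat.one_le_two_pow]

/-- For multiplication and division, powers of two rather than exponents are needed, so the lengths
are the sizes of `low α` and `low₂ α`. -/
theorem exists_header_size (l₀ : ℕ) : ∃ l ≥ l₀, ∀ m, ∃ c ≥ m, ∃ h < 2 ^ c, ∀ q,
    (low (2 ^ c * q + h)).size = l ∧ (low₂ (2 ^ c * q + h)).size = c := by
  refine ⟨l₀ + 1, by omega, fun m => ?_⟩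
  obtain ⟨h, hh, H⟩ := exists_header l₀ m
  refine ⟨_, by omega, h, hh, fun q => ?_⟩
  rw [(H q).1, (H q).2, size_two_pow_sub_one, size_two_pow_sub_one]
  exact ⟨rfl, rfl⟩

/-- For shifts, exponents are needed, and the lengths are the numbers `low α` and `low₂ α`
themselves. -/
theorem exists_header_shift (l₀ : ℕ) : ∃ l ≥ l₀, ∀ m, ∃ c ≥ m, ∃ h < 2 ^ c, ∀ q,
    low (2 ^ c * q + h) = l ∧ low₂ (2 ^ c * q + h) = c ∧ l ≤ c := by
  have hlt : ∀ k, k + 1 ≤ 2 ^ k := fun k => Nat.lt_two_pow_self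
  refine ⟨2 ^ (l₀ + 1) - 1, by have := hlt (l₀ + 1); omega, fun m => ?_⟩
  obtain ⟨h, hh, H⟩ := exists_header l₀ m
  have hc := hlt (l₀ + m + 2)
  refine ⟨2 ^ (l₀ + m + 2) - 1, by omega, h,
    lt_of_lt_of_le hh (Nat.pow_le_pow_right (by norm_num) (by omega)), fun q => ?_⟩
  have e : 2 ^ (2 ^ (l₀ + m + 2) - 1) * q =
      2 ^ (l₀ + m + 2) * (2 ^ (2 ^ (l₀ + m + 2) - 1 - (l₀ + m + 2)) * q) := by
    rw [← mul_assoc, ← pow_add]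
    congr 2
    omega
  have hle : 2 ^ (l₀ + 1) ≤ 2 ^ (l₀ + m + 2) := Nat.pow_le_pow_right (by norm_num) (by omega)
  rw [e, (H _).1, (H _).2]
  exact ⟨rfl, rfl, by omega⟩

theorem Straightline.app₂ {G : ℕ → ℕ → ℕ}
    (ho : (⟨2, fun a => some (G (a 0) (a 1))⟩ : Operation) ∈ op)
    {A B : ℕ → ℕ → ℕ} (hA : Straightline op A) (hB : Straightline op B) :
    Straightline op fun n α => G (A n α) (B n α) :=
  .app _ ho ![A, B] _ (fun j : Fin 2 => by fin_cases j <;> assumption) fun _ _ => rfl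

theorem decodesTuples_mul (hb : boolOps ⊆ op) (hi : incOp ∈ op) (ho : mulOp ∈ op) :
    DecodesTuples op := by
  have hmul : ∀ {A B}, Straightline op A → Straightline op B →
      Straightline op fun n α => A n α * B n α := fun hA hB => Straightline.app₂ ho hA hB
  refine decodesTuples_of_up hb (fun α => (low₂ α).size) (fun α => (low α).size) ?_ ?_ ?_ ?_
    one_le_size_low exists_header_size
  · exact (Straightline.low₂ hb hi .oracle).ones hb
  · intro F hF
    simpa only [low₂, two_pow_size_low] using hmul hF ((Straightline.low₂ hb hi .oracle).succ hi)
  · intro F hF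
    exact hmul (Straightline.one.succ hi) hF
  · intro F hF
    simpa only [two_pow_size_low] using hmul ((Straightline.low hb hi .oracle).succ hi) hF

theorem decodesTuples_shiftLeft (hb : boolOps ⊆ op) (hi : incOp ∈ op) (ho : shiftLeftOp ∈ op) :
    DecodesTuples op := by
  have hshl : ∀ {A B}, Straightline op A → Straightline op B →
      Straightline op fun n α => A n α * 2 ^ B n α :=
    fun hA hB => Straightline.app₂ (G := fun a b => a * 2 ^ b) ho hA hB
  refine decodesTuples_of_up hb low₂ low ?_ ?_ ?_ ?_ one_le_low fun l₀ => ?_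
  · -- The negation of `2 ^ b` is `2 ^ b - 1`: it ends with the most significant bit of its operand.
    have hp : Straightline op fun _ α => 2 ^ low₂ α := by
      simpa using hshl .one (Straightline.low₂ hb hi .oracle)
    convert (hp.ones hb).xor hb hp using 3 with n α
    rw [Nat.size_pow]
    apply Nat.eq_of_testBit_eq
    intro i
    rw [Nat.testBit_xor, Nat.testBit_two_pow_sub_one, Nat.testBit_two_pow_sub_one,
      Nat.testBit_two_pow]
    rcases lt_trichotomy i (low₂ α) with h | h | h
    · simp [h, h.ne', Nat.lt_succ_of_lt h]
    · simp [h]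
    · simp [h.ne, not_lt.mpr h.le, not_lt.mpr (Nat.succ_le_of_lt h)]
  · exact fun F hF => hshl hF (Straightline.low₂ hb hi .oracle)
  · intro F hF
    simpa [mul_comm] using hshl hF .one
  · intro F hF
    simpa [mul_comm] using hshl hF (Straightline.low hb hi .oracle)
  · obtain ⟨l, hl, h⟩ := exists_header_shift l₀
    refine ⟨l, hl, fun m => ?_⟩
    obtain ⟨c, hc, r, hr, h⟩ := h m
    exact ⟨c, hc, r, hr, fun q => ⟨(h q).1, (h q).2.1⟩⟩

theorem eq_mul_iff_div_eq (g f m : ℕ) :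
    g = 2 ^ m * f ↔ g / 2 ^ m = f ∧ g &&& (2 ^ m - 1) = 0 := by
  rw [Nat.and_two_pow_sub_one_eq_mod]
  constructor
  · rintro rfl
    simp
  · rintro ⟨h1, h2⟩
    rw [← Nat.div_add_mod g (2 ^ m), h1, h2, add_zero]

theorem decodesTuples_exactDiv (hb : boolOps ⊆ op) (hi : incOp ∈ op) (ho : exactDivOp ∈ op) :
    DecodesTuples op := by
  -- Once the lower bits of the dividend are cleared, a division by a power of two is exact.
  have hdiv : ∀ {A : ℕ → ℕ → ℕ} {m : ℕ → ℕ}, Straightline op A →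
      (Straightline op fun _ α => 2 ^ m α - 1) → Straightline op fun n α => A n α / 2 ^ m α := by
    intro A m hA hm
    refine .app exactDivOp ho
      ![fun n α => Nat.ldiff (A n α) (2 ^ m α - 1), fun _ α => 2 ^ m α - 1 + 1] _
      (fun j : Fin 2 => by fin_cases j; exacts [hA.ldiff hb hm, hm.succ hi]) fun n α => ?_
    have h1 : 2 ^ m α - 1 + 1 = 2 ^ m α := Nat.sub_add_cancel Nat.one_le_two_pow
    have h2 : Nat.ldiff (A n α) (2 ^ m α - 1) = 2 ^ m α * (A n α / 2 ^ m α) := by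
      apply Nat.eq_of_testBit_eq
      intro i
      rw [Nat.testBit_ldiff, Nat.testBit_two_pow_sub_one, Nat.testBit_two_pow_mul,
        Nat.testBit_div_two_pow]
      by_cases h : i < m α
      · simp [h]
      · simp [h, not_lt.mp h]
    simp [exactDivOp, h1, h2]
  have h1 : Straightline op fun _ α => 2 ^ (low α).size - 1 :=
    (Straightline.low hb hi .oracle).ones hb
  have h2 : Straightline op fun _ α => 2 ^ (low₂ α).size - 1 :=
    (Straightline.low₂ hb hi .oracle).ones hb
  refine decodesTuples_of_down hb (fun α => (low₂ α).size) (fun α => (low α).size) _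
    (fun _ => True) 1 h2 ?_ ?_ ?_ one_le_size_low ?_
  · exact fun F hF => hdiv hF h2
  · intro F G hF hG
    refine ((StraightlineTest.eq hb (hdiv (m := fun _ => 1) hG .one) hF).and hb
      (.eq hb (hG.and hb .one) .zero)).congr fun n α => ?_
    simpa using eq_mul_iff_div_eq (G n α) (F n α) 1
  · intro F G hF hG
    refine ((StraightlineTest.eq hb (hdiv hG h1) hF).and hb
      (.eq hb (hG.and hb h1) .zero)).congr fun n α => ?_
    simpa using eq_mul_iff_div_eq (G n α) (F n α) (low α).size
  · intro l₀
    obtain ⟨l, hl, h⟩ := exists_header_size l₀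
    refine ⟨l, hl, fun m => ?_⟩
    obtain ⟨c, hc, r, hr, h⟩ := h m
    refine ⟨c, hc, r, by simpa using hr, fun q => ?_⟩
    rw [pow_one]
    exact ⟨(h q).1, (h q).2, by rw [(h q).2], trivial⟩

/-- For the right shift, the masks `2 ^ L α - 1` and `2 ^ b α - 1` are read off blocks `1` and `2`
of `α`, as `low` of what remains of `α` from there on; the former mask is checked. -/
theorem decodesTuples_shiftRight (hb : boolOps ⊆ op) (hi : incOp ∈ op) (ho : shiftRightOp ∈ op) :
    DecodesTuples op := by
  have hshr : ∀ {A B}, Straightline op A → Straightline op B →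
      Straightline op fun n α => A n α / 2 ^ B n α :=
    fun hA hB => Straightline.app₂ (G := fun a b => a / 2 ^ b) ho hA hB
  have h1 : Straightline op fun _ α => low α := .low hb hi .oracle
  have h2 : Straightline op fun _ α => low₂ α := .low₂ hb hi .oracle
  have h3 : Straightline op fun _ α => low (α / 2 ^ low₂ α) := .low hb hi (hshr .oracle h2)
  refine decodesTuples_of_down hb low₂ low (fun α => low (α / 2 ^ low₂ α / 2 ^ low₂ α))
    (fun α => low (α / 2 ^ low₂ α) = 2 ^ low α - 1) 3 (.low hb hi (hshr (hshr .oracle h2) h2))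
    (fun F hF => hshr hF h2) ?_ ?_ one_le_low ?_
  · intro F G hF hG
    refine ((StraightlineTest.eq hb (hshr hG .one) hF).and hb
      (.eq hb (hG.and hb .one) .zero)).congr fun n α => ?_
    simpa using eq_mul_iff_div_eq (G n α) (F n α) 1
  · intro F G hF hG
    refine ((StraightlineTest.eq hb (hshr (h3.succ hi) h1) .one).and hb
      ((StraightlineTest.eq hb (hshr hG h1) hF).and hb
        (.eq hb (hG.and hb h3) .zero))).congr fun n α => ?_
    have hok : low (α / 2 ^ low₂ α) = 2 ^ low α - 1 ↔
        (low (α / 2 ^ low₂ α) + 1) / 2 ^ low α = 1 := by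
      obtain ⟨k, hk⟩ := exists_low_eq (α / 2 ^ low₂ α)
      have hp := Nat.one_le_two_pow (n := low α)
      constructor
      · intro h
        rw [h, Nat.sub_add_cancel hp, Nat.div_self hp]
      · intro h
        rw [hk, Nat.sub_add_cancel Nat.one_le_two_pow] at h
        rw [hk]
        rcases le_total (low α) (k + 1) with hle | hle
        · rw [Nat.pow_div hle (by norm_num)] at h
          have := (Nat.pow_eq_one.mp h).resolve_left (by norm_num)
          rw [le_antisymm hle (Nat.sub_eq_zero_iff_le.mp this)]
        · have := Nat.div_mul_le_self (2 ^ (k + 1)) (2 ^ low α)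
          rw [h, one_mul] at this
          rw [le_antisymm this (Nat.pow_le_pow_right (by norm_num) hle)]
    rw [← hok]
    refine and_congr_right fun h => ?_
    rw [h]
    exact eq_mul_iff_div_eq _ _ _
  · intro l₀
    obtain ⟨l, hl, h⟩ := exists_header_shift (l₀ + 1)
    refine ⟨l, by omega, fun m => ?_⟩
    obtain ⟨c, hc, r, hr, h⟩ := h m
    have hlc := (h 0).2.2
    obtain ⟨k, rfl⟩ : ∃ k, l = k + 1 := ⟨l - 1, by omega⟩
    obtain ⟨e, rfl⟩ : ∃ e, c = e + 1 := ⟨c - 1, by omega⟩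
    have hk := Nat.one_le_two_pow (n := k)
    have he := Nat.one_le_two_pow (n := e)
    have hke : 2 ^ k ≤ 2 ^ e := Nat.pow_le_pow_right (by norm_num) (by omega)
    have hee : 2 ^ (e + 1) = 2 * 2 ^ e := by ring
    have split : ∀ a q, a < 2 ^ (e + 1) → (2 ^ (e + 1) * q + a) / 2 ^ (e + 1) = q := by
      intro a q ha
      rw [Nat.mul_add_div (by positivity), Nat.div_eq_of_lt ha, add_zero]
    refine ⟨e + 1, hc, 2 ^ (e + 1) * (2 ^ (e + 1) * (2 ^ e - 1) + (2 ^ k - 1)) + r, ?_, fun q => ?_⟩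
    · have a1 : 2 ^ (e + 1) * (2 ^ e - 1) + (2 ^ k - 1) < 2 ^ (e + 1) * 2 ^ (e + 1) := by
        have : 2 ^ (e + 1) * (2 ^ e - 1 + 1) ≤ 2 ^ (e + 1) * 2 ^ (e + 1) :=
          Nat.mul_le_mul_left _ (by omega)
        rw [Nat.mul_add] at this
        omega
      have := Nat.mul_le_mul_left (2 ^ (e + 1)) (Nat.succ_le_of_lt a1)
      rw [Nat.succ_eq_add_one, Nat.mul_add] at this
      calc _ < _ := by omega
        _ ≤ _ := this
        _ = _ := by ring
    · have e0 : (2 ^ (e + 1)) ^ 3 * q +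
          (2 ^ (e + 1) * (2 ^ (e + 1) * (2 ^ e - 1) + (2 ^ k - 1)) + r) =
          2 ^ (e + 1) * (2 ^ (e + 1) * (2 ^ (e + 1) * q + (2 ^ e - 1)) + (2 ^ k - 1)) + r := by
        ring
      rw [e0]
      obtain ⟨H1, H2, -⟩ := h (2 ^ (e + 1) * (2 ^ (e + 1) * q + (2 ^ e - 1)) + (2 ^ k - 1))
      rw [H1, H2, split _ _ hr, split _ _ (by omega)]
      refine ⟨rfl, rfl, low_two_pow_mul_add _ _, ?_⟩
      have : 2 ^ (e + 1) * (2 ^ (e + 1) * q + (2 ^ e - 1)) =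
          2 ^ (k + 1) * (2 ^ (e - k) * (2 ^ (e + 1) * q + (2 ^ e - 1))) := by
        rw [← mul_assoc, ← pow_add]
        congr 2
        omega
      rw [this]
      exact low_two_pow_mul_add _ _

end

section

/-! ### Nondeterministic counter programs -/

/-- Nondeterministic programs over counters: regular expressions over the atomic actions of
incrementing a counter, decrementing a nonzero counter, and passing only if a counter is zero. -/
inductive CounterProg where
  | inc (i : ℕ)
  | dec (i : ℕ)
  | isZero (i : ℕ)
  | seq (P Q : CounterProg)
  | star (P : CounterProg)

/-- The relation between the counters before and after a run of a program. -/
def CounterProg.Run : CounterProg → (ℕ → ℕ) → (ℕ → ℕ) → Prop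
  | inc i, s, s' => s' = s + Pi.single i 1
  | dec i, s, s' => s' + Pi.single i 1 = s
  | isZero i, s, s' => s' = s ∧ s i = 0
  | seq P Q, s, s' => ∃ t, P.Run s t ∧ Q.Run t s'
  | star P, s, s' => Relation.ReflTransGen P.Run s s'

namespace CounterProg

theorem run_seq (P Q : CounterProg) (s s' : ℕ → ℕ) :
    (seq P Q).Run s s' ↔ ∃ t, P.Run s t ∧ Q.Run t s' := Iff.rfl

theorem run_isZero (i : ℕ) (s s' : ℕ → ℕ) : (isZero i).Run s s' ↔ s' = s ∧ s i = 0 := Iff.rfl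

/-- The effect of `P` is to subtract `d`, where this is possible, and then to add `u`. -/
def IsTranslation (P : CounterProg) (d u : ℕ → ℕ) : Prop :=
  ∀ s s', P.Run s s' ↔ ∃ t, s = t + d ∧ s' = t + u

theorem isTranslation_inc (i : ℕ) : (inc i).IsTranslation 0 (Pi.single i 1) :=
  fun s s' => by simp [Run]

theorem isTranslation_dec (i : ℕ) : (dec i).IsTranslation (Pi.single i 1) 0 :=
  fun s s' => by simp [Run, eq_comm]

theorem IsTranslation.dec_seq {P : CounterProg} {d u : ℕ → ℕ} (h : P.IsTranslation d u) (i : ℕ) :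
    (seq (dec i) P).IsTranslation (d + Pi.single i 1) u := by
  intro s s'
  simp only [run_seq, h _ _, isTranslation_dec i _ _]
  constructor
  · rintro ⟨_, ⟨t, rfl, rfl⟩, t', ht, rfl⟩
    exact ⟨t', by rw [← add_assoc, ← ht, add_zero], rfl⟩
  · rintro ⟨t, rfl, rfl⟩
    exact ⟨_, ⟨t + d, (add_assoc _ _ _).symm, rfl⟩, t, by simp, rfl⟩

theorem IsTranslation.seq_inc {P : CounterProg} {d u : ℕ → ℕ} (h : P.IsTranslation d u) (i : ℕ) :
    (seq P (inc i)).IsTranslation d (u + Pi.single i 1) := by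
  intro s s'
  simp only [run_seq, h _ _, isTranslation_inc i _ _]
  constructor
  · rintro ⟨_, ⟨t, rfl, rfl⟩, t', ht, rfl⟩
    exact ⟨t, rfl, by rw [← add_assoc, ht, add_zero]⟩
  · rintro ⟨t, rfl, rfl⟩
    exact ⟨_, ⟨t, rfl, rfl⟩, t + u, by simp, by rw [add_assoc]⟩

theorem IsTranslation.run_star {P : CounterProg} {d u : ℕ → ℕ} (hP : P.IsTranslation d u)
    (hdu : ∀ i, d i = 0 ∨ u i = 0) (s s' : ℕ → ℕ) :
    (star P).Run s s' ↔ ∃ (k : ℕ) (t : ℕ → ℕ), s = t + k • d ∧ s' = t + k • u := by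
  constructor
  · intro h
    induction h with
    | refl => exact ⟨0, s, by simp⟩
    | tail _ h ih =>
      obtain ⟨k, t, rfl, rfl⟩ := ih
      obtain ⟨t', ht, rfl⟩ := (hP _ _).mp h
      have hd : d ≤ t := by
        intro i
        have := congrFun ht i
        simp only [Pi.add_apply, Pi.smul_apply, smul_eq_mul] at this
        rcases hdu i with h | h
        · simp [h]
        · rw [h, mul_zero, add_zero] at this
          rw [this]
          exact Nat.le_add_left _ _
      obtain ⟨r, rfl⟩ := exists_add_of_le hd
      refine ⟨k + 1, r, by rw [succ_nsmul', ← add_assoc, add_comm r], ?_⟩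
      have : t' = r + k • u := by
        rw [add_comm d, add_right_comm] at ht
        exact (add_right_cancel ht).symm
      rw [this, succ_nsmul, add_assoc]
  · rintro ⟨k, t, rfl, rfl⟩
    induction k generalizing t with
    | zero =>
      simp only [zero_smul, add_zero]
      exact Relation.ReflTransGen.refl
    | succ k ih =>
      refine Relation.ReflTransGen.head ((hP _ _).mpr ⟨t + k • d, by rw [succ_nsmul, add_assoc],
        rfl⟩) ?_
      rw [add_right_comm, succ_nsmul', ← add_assoc]
      exact ih _

theorem run_star_inc (i : ℕ) (s s' : ℕ → ℕ) :
    (star (inc i)).Run s s' ↔ ∃ x, s' = s + Pi.single i x := by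
  rw [(isTranslation_inc i).run_star fun j => .inl rfl]
  simp [← Pi.single_smul]

/-- The program setting counter `i` to zero. -/
def clear (i : ℕ) : CounterProg := seq (star (dec i)) (isZero i)

theorem run_clear (i : ℕ) (s s' : ℕ → ℕ) :
    (clear i).Run s s' ↔ s' = Function.update s i 0 := by
  simp only [clear, run_seq, run_isZero, (isTranslation_dec i).run_star fun j => .inr rfl]
  constructor
  · rintro ⟨_, ⟨k, t, rfl, rfl⟩, rfl, h0⟩
    funext j
    by_cases h : j = i
    · subst h; simpa using h0
    · simp [h]
  · rintro rfl
    refine ⟨_, ⟨s i, Function.update s i 0, ?_, by simp⟩, rfl, by simp⟩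
    funext j
    by_cases h : j = i
    · subst h; simp
    · simp [h]

/-- The loop that adds counter `i` to counter `j` and sets `i` to zero. -/
def move (i j : ℕ) : CounterProg :=
  seq (star (seq (dec i) (inc j))) (isZero i)

theorem run_move {i j : ℕ} (hij : i ≠ j) (s s' : ℕ → ℕ) :
    (move i j).Run s s' ↔ s' = Function.update (Function.update s i 0) j (s j + s i) := by
  simp only [move, run_seq _ (isZero i), run_isZero,
    ((isTranslation_inc j).dec_seq i).run_star (fun a => by
      by_cases ha : a = i
      · subst ha; simp [hij]
      · simp [ha])]
  constructor
  · rintro ⟨_, ⟨k, t, rfl, rfl⟩, rfl, h0⟩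
    have hi : t i = 0 := by simpa [hij] using h0
    funext a
    by_cases ha : a = j
    · subst ha; simp [hij.symm, hi]
    · by_cases ha' : a = i
      · subst ha'; simp [ha, hi]
      · simp [ha, ha']
  · rintro rfl
    refine ⟨_, ⟨s i, Function.update s i 0, ?_, rfl⟩, ?_, by simp [hij]⟩
    all_goals
      funext a
      by_cases ha : a = j
      · subst ha; simp [hij.symm]
      · by_cases ha' : a = i
        · subst ha'; simp [ha]
        · simp [ha, ha']

end CounterProg

open CounterProg

/-! ### Predicates tested by counter programs -/

/-- Some program tests `φ`, using the counters from `b` on, initially zero, as auxiliary counters: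
it has a run exactly if `φ` holds, and then the run ends with all counters restored. -/
def Testable (b : ℕ) (φ : (ℕ → ℕ) → Prop) : Prop :=
  ∃ P : CounterProg, ∀ s, (∀ i, b ≤ i → s i = 0) → ∀ s', P.Run s s' ↔ s' = s ∧ φ s

theorem Testable.congr {b : ℕ} {φ ψ : (ℕ → ℕ) → Prop} (h : Testable b φ)
    (hφ : ∀ s, (∀ i, b ≤ i → s i = 0) → (ψ s ↔ φ s)) : Testable b ψ := by
  obtain ⟨P, hP⟩ := h
  exact ⟨P, fun s hs s' => by rw [hP s hs, hφ s hs]⟩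

theorem Testable.and {b : ℕ} {φ ψ : (ℕ → ℕ) → Prop} (hφ : Testable b φ) (hψ : Testable b ψ) :
    Testable b fun s => φ s ∧ ψ s := by
  obtain ⟨P, hP⟩ := hφ
  obtain ⟨Q, hQ⟩ := hψ
  refine ⟨seq P Q, fun s hs s' => ?_⟩
  simp only [run_seq, hP s hs]
  constructor
  · rintro ⟨t, ⟨rfl, h⟩, h'⟩
    rw [hQ t hs] at h'
    exact ⟨h'.1, h, h'.2⟩
  · rintro ⟨rfl, h, h'⟩
    exact ⟨_, ⟨rfl, h⟩, (hQ _ hs _).mpr ⟨rfl, h'⟩⟩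

theorem testable_isZero (b i : ℕ) : Testable b fun s => s i = 0 :=
  ⟨isZero i, fun _ _ _ => Iff.rfl⟩

theorem testable_true (b : ℕ) : Testable b fun _ => True :=
  (testable_isZero b b).congr fun s hs => by simp [hs b le_rfl]

theorem Testable.forall_fin {b m : ℕ} {φ : Fin m → (ℕ → ℕ) → Prop} (h : ∀ j, Testable b (φ j)) :
    Testable b fun s => ∀ j, φ j s := by
  induction m with
  | zero => exact (testable_true b).congr fun s _ => by simp
  | succ m ih =>
    exact ((h 0).and (ih fun j => h j.succ)).congr fun s _ => Fin.forall_fin_succ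

/-- Existential quantification: guess a value in counter `b`, test, and clear the counter. -/
theorem Testable.exists {b : ℕ} {φ : (ℕ → ℕ) → Prop} (h : Testable (b + 1) φ) :
    Testable b fun s => ∃ x, φ (Function.update s b x) := by
  obtain ⟨P, hP⟩ := h
  refine ⟨seq (star (inc b)) (seq P (clear b)), fun s hs s' => ?_⟩
  have hx : ∀ x, s + Pi.single b x = Function.update s b x := by
    intro x
    funext i
    by_cases hi : i = b
    · subst hi; simp [hs]
    · simp [hi]
  have hcl : ∀ x, ∀ i, b + 1 ≤ i → Function.update s b x i = 0 := by
    intro x i hi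
    rw [Function.update_of_ne (by omega), hs i (by omega)]
  have h0 : Function.update s b 0 = s := by
    rw [← hs b le_rfl, Function.update_eq_self]
  simp only [run_seq, run_star_inc, hx, run_clear]
  constructor
  · rintro ⟨t, ⟨x, rfl⟩, u, hu, rfl⟩
    rw [hP _ (hcl x)] at hu
    obtain ⟨rfl, hu⟩ := hu
    exact ⟨by simpa using h0, x, hu⟩
  · rintro ⟨rfl, x, hx⟩
    exact ⟨_, ⟨x, rfl⟩, _, (hP _ (hcl x) _).mpr ⟨rfl, hx⟩, by simpa using h0.symm⟩

/-- Equality of two counters: decrease both in parallel, test for zero, and restore both. -/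
theorem testable_eq {b i j : ℕ} (hij : i ≠ j) (hi : i < b) (hj : j < b) :
    Testable b fun s => s i = s j := by
  have hb : ∀ a, a = i ∨ a = j → a ≠ b := by omega
  have hdis : ∀ a, (Pi.single i 1 + Pi.single j 1 : ℕ → ℕ) a = 0 ∨
      (Pi.single b 1 : ℕ → ℕ) a = 0 := by
    intro a
    by_cases ha : a = b
    · subst ha
      simp [hi.ne', hj.ne']
    · simp [ha]
  have hdown := (((isTranslation_inc b).dec_seq j).dec_seq i).run_star (fun a => by
    simpa [add_comm] using hdis a)
  have hup := (((isTranslation_dec b).seq_inc i).seq_inc j).run_star (fun a => by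
    simpa [or_comm] using hdis a)
  refine ⟨seq (star (seq (dec i) (seq (dec j) (inc b)))) (seq (isZero i) (seq (isZero j)
    (seq (star (seq (seq (dec b) (inc i)) (inc j))) (isZero b)))), fun s hs s' => ?_⟩
  have hs0 := hs b le_rfl
  rw [run_seq]
  simp only [run_seq _ (seq (isZero j) _), run_seq _ (seq (star _) (isZero b)),
    run_seq _ (isZero b), run_isZero, hdown, hup, zero_add]
  constructor
  · rintro ⟨_, ⟨k, t, rfl, rfl⟩, _, ⟨rfl, h1⟩, _, ⟨rfl, h2⟩, _, ⟨k', t', h, rfl⟩, rfl, h3⟩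
    have ti : t i = 0 := by simpa [hi.ne] using h1
    have tj : t j = 0 := by simpa [hj.ne] using h2
    have tb : t b = 0 := by simpa [hi.ne', hj.ne'] using hs0
    have tb' : t' b = 0 := by simpa [hi.ne', hj.ne'] using h3
    have hk : k = k' := by simpa [tb, tb'] using congrFun h b
    subst hk
    have : t = t' := add_right_cancel h
    subst this
    refine ⟨by rw [add_comm (Pi.single i 1)], ?_⟩
    simp [ti, tj, hij, hij.symm]
  · rintro ⟨rfl, h⟩
    refine ⟨_, ⟨s' i, Function.update (Function.update s' i 0) j 0, ?_, rfl⟩, _,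
      ⟨rfl, ?_⟩, _, ⟨rfl, ?_⟩, _, ⟨s' i, _, rfl, rfl⟩, ?_, ?_⟩
    · funext a
      by_cases ha : a = j
      · subst ha; simp [hij.symm, h]
      · by_cases ha' : a = i
        · subst ha'; simp [ha]
        · simp [ha, ha']
    · simp [hij, hi.ne]
    · simp [hj.ne]
    · funext a
      by_cases ha : a = j
      · subst ha; simp [hij.symm, h]
      · by_cases ha' : a = i
        · subst ha'; simp [ha]
        · simp [ha, ha']
    · simp [hi.ne', hj.ne', hs0]

/-- `s` with counter `b` set to `m` and counter `b + 1` set to `a`. -/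
def setTwo (b : ℕ) (s : ℕ → ℕ) (m a : ℕ) : ℕ → ℕ :=
  Function.update (Function.update s b m) (b + 1) a

theorem setTwo_of_lt {b i : ℕ} (h : i < b) (s : ℕ → ℕ) (m a : ℕ) : setTwo b s m a i = s i := by
  rw [setTwo, Function.update_of_ne (by omega), Function.update_of_ne (by omega)]

theorem setTwo_self (b : ℕ) (s : ℕ → ℕ) (m a : ℕ) : setTwo b s m a b = m := by
  simp [setTwo]

theorem setTwo_succ (b : ℕ) (s : ℕ → ℕ) (m a : ℕ) : setTwo b s m a (b + 1) = a := by
  simp [setTwo]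

theorem setTwo_of_gt {b i : ℕ} (h : b + 1 < i) (s : ℕ → ℕ) (m a : ℕ) :
    setTwo b s m a i = s i := by
  rw [setTwo, Function.update_of_ne (by omega), Function.update_of_ne (by omega)]

/-- Iteration: counter `b` counts the steps of a loop and counter `b + 1` runs through a sequence
`a 0, a 1, …`; the next value is guessed in counter `b + 2`, and `ψ` is tested before it replaces
the current one. -/
theorem Testable.iterate {b : ℕ} {χ₀ χ₁ ψ : (ℕ → ℕ) → Prop} (h₀ : Testable (b + 2) χ₀)
    (hψ : Testable (b + 3) ψ) (h₁ : Testable (b + 2) χ₁) :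
    Testable b fun s => ∃ (k : ℕ) (a : ℕ → ℕ), χ₀ (setTwo b s 0 (a 0)) ∧
      (∀ m < k, ψ (Function.update (setTwo b s m (a m)) (b + 2) (a (m + 1)))) ∧
      χ₁ (setTwo b s k (a k)) := by
  obtain ⟨P₀, h₀⟩ := h₀
  obtain ⟨P₁, h₁⟩ := h₁
  obtain ⟨Q, hQ⟩ := hψ
  let body : CounterProg := seq (star (inc (b + 2))) (seq Q (seq (clear (b + 1))
    (seq (move (b + 2) (b + 1)) (inc b))))
  have hbody : ∀ s, (∀ i, b ≤ i → s i = 0) → ∀ m a s', body.Run (setTwo b s m a) s' ↔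
      ∃ x, ψ (Function.update (setTwo b s m a) (b + 2) x) ∧ s' = setTwo b s (m + 1) x := by
    intro s hs m a s'
    have e1 : ∀ x, setTwo b s m a + Pi.single (b + 2) x =
        Function.update (setTwo b s m a) (b + 2) x := by
      intro x
      funext i
      by_cases hi : i = b + 2
      · subst hi; simp [setTwo_of_gt, hs]
      · simp [hi]
    have hcl : ∀ x i, b + 3 ≤ i → Function.update (setTwo b s m a) (b + 2) x i = 0 := by
      intro x i hi
      rw [Function.update_of_ne (by omega), setTwo_of_gt (by omega), hs _ (by omega)]
    have e2 : ∀ x, Function.update (Function.update (Function.update (Function.update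
        (setTwo b s m a) (b + 2) x) (b + 1) 0) (b + 2) 0) (b + 1) x + Pi.single b 1 =
        setTwo b s (m + 1) x := by
      intro x
      funext i
      rcases lt_trichotomy i b with hi | rfl | hi
      · simp [setTwo_of_lt hi, hi.ne, show i ≠ b + 1 by omega, show i ≠ b + 2 by omega]
      · simp [setTwo]
      · by_cases h1 : i = b + 1
        · subst h1; simp [setTwo]
        · by_cases h2 : i = b + 2
          · subst h2; simp [setTwo, hs]
          · simp [setTwo, h1, h2, hi.ne']
    simp only [body, run_seq, run_star_inc, e1, run_clear, run_move (show b + 2 ≠ b + 1 by omega)]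
    constructor
    · rintro ⟨_, ⟨x, rfl⟩, u, hu, _, rfl, _, rfl, hs'⟩
      rw [hQ _ (hcl x)] at hu
      obtain ⟨rfl, hu⟩ := hu
      refine ⟨x, hu, ?_⟩
      rw [← e2]
      simpa [Run] using hs'
    · rintro ⟨x, hx, rfl⟩
      refine ⟨_, ⟨x, rfl⟩, _, (hQ _ (hcl x) _).mpr ⟨rfl, hx⟩, _, rfl, _, rfl, ?_⟩
      rw [← e2]
      simp [Run]
  have hstar : ∀ s, (∀ i, b ≤ i → s i = 0) → ∀ a₀ s', (star body).Run (setTwo b s 0 a₀) s' ↔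
      ∃ (k : ℕ) (a : ℕ → ℕ), a 0 = a₀ ∧
        (∀ m < k, ψ (Function.update (setTwo b s m (a m)) (b + 2) (a (m + 1)))) ∧
        s' = setTwo b s k (a k) := by
    intro s hs a₀ s'
    constructor
    · intro h
      induction h with
      | refl => exact ⟨0, fun _ => a₀, rfl, by simp, rfl⟩
      | tail _ h ih =>
        obtain ⟨k, a, ha, hk, rfl⟩ := ih
        obtain ⟨x, hx, rfl⟩ := (hbody s hs _ _ _).mp h
        refine ⟨k + 1, Function.update a (k + 1) x, by simpa using ha, fun m hm => ?_, by simp⟩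
        rcases Nat.lt_succ_iff_lt_or_eq.mp hm with hm | rfl
        · rw [Function.update_of_ne (by omega), Function.update_of_ne (by omega)]
          exact hk m hm
        · simpa using hx
    · rintro ⟨k, a, rfl, hk, rfl⟩
      induction k with
      | zero => exact .refl
      | succ k ih =>
        exact .tail (ih fun m hm => hk m (by omega))
          ((hbody s hs _ _ _).mpr ⟨_, hk k (by omega), rfl⟩)
  refine ⟨seq (star (inc (b + 1))) (seq P₀ (seq (star body) (seq P₁ (seq (clear b)
    (clear (b + 1)))))), fun s hs s' => ?_⟩
  have e0 : ∀ x, s + Pi.single (b + 1) x = setTwo b s 0 x := by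
    intro x
    funext i
    by_cases hi : i = b + 1
    · subst hi; simp [setTwo, hs]
    · by_cases hi' : i = b
      · subst hi'; simp [setTwo, hs]
      · simp [setTwo, hi, hi']
  have e1 : ∀ m x, Function.update (Function.update (setTwo b s m x) b 0) (b + 1) 0 = s := by
    intro m x
    funext i
    by_cases hi : i = b + 1
    · subst hi; simp [hs]
    · by_cases hi' : i = b
      · subst hi'; simp [hs]
      · simp [setTwo, hi, hi']
  have hcl : ∀ m x i, b + 2 ≤ i → setTwo b s m x i = 0 := by
    intro m x i hi
    rw [setTwo_of_gt (by omega), hs _ (by omega)]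
  simp only [run_seq, run_star_inc, e0, run_clear]
  constructor
  · rintro ⟨_, ⟨x, rfl⟩, _, hu, _, hv, _, hw, _, rfl, rfl⟩
    obtain ⟨rfl, hu'⟩ := (h₀ _ (hcl _ _) _).mp hu
    obtain ⟨k, a, rfl, hk, rfl⟩ := (hstar s hs _ _).mp hv
    obtain ⟨rfl, hw'⟩ := (h₁ _ (hcl _ _) _).mp hw
    exact ⟨e1 _ _, k, a, hu', hk, hw'⟩
  · rintro ⟨rfl, k, a, hu, hk, hw⟩
    exact ⟨_, ⟨a 0, rfl⟩, _, (h₀ _ (hcl _ _) _).mpr ⟨rfl, hu⟩, _,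
      (hstar _ hs _ _).mpr ⟨k, a, rfl, hk, rfl⟩, _, (h₁ _ (hcl _ _) _).mpr ⟨rfl, hw⟩, _, rfl,
      (e1 _ _).symm⟩

theorem testable_succ {b i j : ℕ} (hij : i ≠ j) (hi : i < b) (hj : j < b) :
    Testable b fun s => s i = s j + 1 := by
  obtain ⟨P, hP⟩ := testable_eq hij hi hj
  refine ⟨seq (dec i) (seq P (inc i)), fun s hs s' => ?_⟩
  simp only [run_seq, isTranslation_dec i _ _, isTranslation_inc i _ _, add_zero]
  have hcl : ∀ t : ℕ → ℕ, s = t + Pi.single i 1 → ∀ a, b ≤ a → t a = 0 := by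
    rintro t rfl a ha
    have := hs a ha
    simp only [Pi.add_apply, Nat.add_eq_zero_iff] at this
    exact this.1
  constructor
  · rintro ⟨_, ⟨t, h, rfl⟩, _, hu, _, rfl, rfl⟩
    obtain ⟨rfl, hu⟩ := (hP _ (hcl _ h) _).mp hu
    subst h
    simp [hij.symm, hu]
  · rintro ⟨rfl, h⟩
    have e : s' = Function.update s' i (s' j) + Pi.single i 1 := by
      funext a
      by_cases ha : a = i
      · subst ha; simp [h]
      · simp [ha]
    exact ⟨_, ⟨_, e, rfl⟩, _, (hP _ (hcl _ e) _).mpr ⟨rfl, by simp [hij.symm]⟩, _, rfl, e⟩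

/-- `s` with the counters `b, …, b + n - 1` set to the values of `x`. -/
def setRange (b n : ℕ) (s x : ℕ → ℕ) : ℕ → ℕ := fun i => if b ≤ i ∧ i < b + n then x i else s i

theorem Testable.exists_range {b : ℕ} (n : ℕ) {φ : (ℕ → ℕ) → Prop} (h : Testable (b + n) φ) :
    Testable b fun s => ∃ x, φ (setRange b n s x) := by
  induction n generalizing φ with
  | zero =>
    refine h.congr fun s _ => ?_
    have : ∀ x, setRange b 0 s x = s := fun x => by
      funext i
      simp only [setRange, add_zero, ite_eq_right_iff]
      omega
    simp [this]
  | succ n ih =>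
    refine (ih (Testable.exists h)).congr fun s _ => ?_
    constructor
    · rintro ⟨x, hx⟩
      refine ⟨x, x (b + n), ?_⟩
      convert hx using 1
      funext i
      by_cases hi : i = b + n
      · subst hi; simp [setRange]
      · have : i < b + (n + 1) ↔ i < b + n := by omega
        simp [setRange, hi, this]
    · rintro ⟨x, y, hx⟩
      refine ⟨Function.update x (b + n) y, ?_⟩
      convert hx using 1
      funext i
      by_cases hi : i = b + n
      · subst hi; simp [setRange]
      · have : i < b + (n + 1) ↔ i < b + n := by omega
        simp [setRange, hi, this]

/-! ### Recursively enumerable sets are accepted by counter programs -/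

/-- The graph of the partial function `f` is testable, wherever arguments and value are placed. -/
def GraphTestable {n : ℕ} (f : List.Vector ℕ n →. ℕ) : Prop :=
  ∀ (b : ℕ) (args : Fin n → ℕ) (out : ℕ), (∀ i, args i < b) → out < b → (∀ i, args i ≠ out) →
    Testable b fun s => s out ∈ f (List.Vector.ofFn fun i => s (args i))

theorem mem_mOfFn {α : Type*} {n : ℕ} (f : Fin n → Part α) (v : List.Vector α n) :
    v ∈ List.Vector.mOfFn f ↔ ∀ i, v.get i ∈ f i := by
  induction n with
  | zero => simp [List.Vector.mOfFn, Part.pure_eq_some, List.Vector.eq_nil v]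
  | succ n ih =>
    simp only [List.Vector.mOfFn, Part.pure_eq_some, Part.bind_eq_bind, Part.mem_bind_iff,
      Part.mem_some_iff, ih, Fin.forall_fin_succ]
    constructor
    · rintro ⟨a, ha, w, hw, rfl⟩
      exact ⟨by simpa using ha, fun i => by simpa using hw i⟩
    · rintro ⟨h0, h⟩
      exact ⟨v.head, by simpa using h0, v.tail, fun i => by simpa using h i, by simp⟩

theorem GraphTestable.comp {m n : ℕ} {f : List.Vector ℕ n →. ℕ}
    {g : Fin n → List.Vector ℕ m →. ℕ} (hf : GraphTestable f) (hg : ∀ i, GraphTestable (g i)) :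
    GraphTestable fun v => (List.Vector.mOfFn fun i => g i v).bind f := by
  intro b args out hargs hout hne
  have h1 : Testable (b + n) fun s => ∀ i : Fin n,
      s (b + i) ∈ g i (List.Vector.ofFn fun i => s (args i)) :=
    Testable.forall_fin fun i => hg i (b + n) args (b + i) (fun j => by have := hargs j; omega)
      (by omega) fun j => by have := hargs j; omega
  have h2 := hf (b + n) (fun i => b + i) out (fun i => by omega) (by omega) fun i => by omega
  refine ((h1.and h2).exists_range).congr fun s _ => ?_
  have e1 : ∀ x, ∀ i, i < b → setRange b n s x i = s i := by
    intro x i hi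
    rw [setRange, if_neg (by omega)]
  have e2 : ∀ x (i : Fin n), setRange b n s x (b + i) = x (b + i) := by
    intro x i
    rw [setRange, if_pos (by omega)]
  simp only [e1 _ _ hout, e2, e1 _ _ (hargs _)]
  refine Part.mem_bind_iff.trans ?_
  simp only [mem_mOfFn]
  constructor
  · rintro ⟨v, hv, h⟩
    refine ⟨fun i => if h : i - b < n then v.get ⟨i - b, h⟩ else 0, fun i => ?_, ?_⟩
    · simpa using hv i
    · simpa using h
  · rintro ⟨x, hx, h⟩
    exact ⟨_, fun i => by simpa using hx i, h⟩

theorem GraphTestable.prec {n : ℕ} {f : List.Vector ℕ n → ℕ} {g : List.Vector ℕ (n + 2) → ℕ}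
    (hf : GraphTestable (n := n) ↑f) (hg : GraphTestable (n := n + 2) ↑g) :
    GraphTestable (n := n + 1) ↑fun v : List.Vector ℕ (n + 1) =>
      (v.head.rec (f v.tail) fun y ih => g (y ::ᵥ ih ::ᵥ v.tail) : ℕ) := by
  intro b args out hargs hout hne
  have h0 := hf (b + 2) (fun i => args i.succ) (b + 1) (fun i => by have := hargs i.succ; omega)
    (by omega) fun i => by have := hargs i.succ; omega
  have hψ := hg (b + 3) (Fin.cons b (Fin.cons (b + 1) fun i => args i.succ)) (b + 2)
    (fun i => by
      refine Fin.cases ?_ (fun i => Fin.cases ?_ (fun i => ?_) i) i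
      · simp
      · simp
      · have := hargs i.succ
        simp; omega)
    (by omega) (fun i => by
      refine Fin.cases ?_ (fun i => Fin.cases ?_ (fun i => ?_) i) i
      · simp
      · simp
      · have := hargs i.succ
        simp; omega)
  have h1 : Testable (b + 2) fun s => s b = s (args 0) ∧ s (b + 1) = s out :=
    (testable_eq (by have := hargs 0; omega) (by omega) (by have := hargs 0; omega)).and
      (testable_eq (by omega) (by omega) (by omega))
  refine (h0.iterate hψ h1).congr fun s _ => ?_
  have e : ∀ m a x i, i < b → Function.update (setTwo b s m a) (b + 2) x i = s i := by
    intro m a x i hi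
    rw [Function.update_of_ne (by omega), setTwo_of_lt hi]
  have e1 : ∀ m a x, Function.update (setTwo b s m a) (b + 2) x b = m := by
    intro m a x
    rw [Function.update_of_ne (by omega), setTwo_self]
  have e2 : ∀ m a x, Function.update (setTwo b s m a) (b + 2) x (b + 1) = a := by
    intro m a x
    rw [Function.update_of_ne (by omega), setTwo_succ]
  simp only [PFun.coe_val, Part.mem_some_iff, List.Vector.ofFn, Fin.cons_zero, Fin.cons_succ,
    setTwo_of_lt hout, setTwo_of_lt (hargs _), setTwo_self, setTwo_succ, Function.update_self,
    e _ _ _ _ (hargs _), e1, e2, List.Vector.head_cons, List.Vector.tail_cons]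
  constructor
  · intro h
    refine ⟨s (args 0), fun m => Nat.rec (motive := fun _ => ℕ) _
      (fun y ih => g (y ::ᵥ ih ::ᵥ _)) m, rfl, fun m _ => rfl, rfl,
      h.symm⟩
  · rintro ⟨k, a, h, h', rfl, h''⟩
    have : ∀ m ≤ s (args 0), a m = m.rec (f (List.Vector.ofFn fun i => s (args i.succ)))
        fun y ih => g (y ::ᵥ ih ::ᵥ (List.Vector.ofFn fun i => s (args i.succ))) := by
      intro m hm
      induction m with
      | zero => exact h
      | succ m ih =>
        rw [h' m (by omega), ih (by omega)]
    rw [← h'', this _ le_rfl]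

theorem GraphTestable.rfind {n : ℕ} {f : List.Vector ℕ (n + 1) → ℕ}
    (hf : GraphTestable (n := n + 1) ↑f) :
    GraphTestable fun v => Nat.rfind fun n => some (decide (f (n ::ᵥ v) = 0)) := by
  intro b args out hargs hout hne
  have hval : ∀ d, 2 ≤ d → ∀ b', b' = b + d → Testable (b' + 1) fun s =>
      s b' ∈ (f : List.Vector ℕ (n + 1) →. ℕ)
        (List.Vector.ofFn fun i => s ((Fin.cons b args : Fin (n + 1) → ℕ) i)) := by
    intro d hd b' hb'
    refine hf (b' + 1) (Fin.cons b args) b' (fun i => ?_) (by omega) fun i => ?_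
    all_goals
      refine Fin.cases ?_ (fun i => ?_) i
      · simp only [Fin.cons_zero]; omega
      · have := hargs i
        simp only [Fin.cons_succ]; omega
  -- The current value is `f (m ::ᵥ v) - 1` of the preceding `m`, so that the step from `m` is
  -- possible exactly if `f (m ::ᵥ v) ≠ 0`.
  have hψ := ((hval 3 (by omega) (b + 3) rfl).and
    (testable_succ (b := b + 3 + 1) (i := b + 3) (j := b + 2) (by omega) (by omega)
      (by omega))).exists
  have h1 := (testable_eq (b := b + 2) (i := b) (j := out) (by omega) (by omega) (by omega)).and
    ((hval 2 le_rfl (b + 2) rfl).and (testable_isZero (b + 2 + 1) (b + 2))).exists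
  refine ((testable_isZero (b + 2) (b + 1)).iterate hψ h1).congr fun s _ => ?_
  have e : ∀ m a x i, i < b → Function.update (setTwo b s m a) (b + 2) x i = s i := by
    intro m a x i hi
    rw [Function.update_of_ne (by omega), setTwo_of_lt hi]
  have e1 : ∀ m a x, Function.update (setTwo b s m a) (b + 2) x b = m := by
    intro m a x
    rw [Function.update_of_ne (by omega), setTwo_self]
  have e' : ∀ (t : ℕ → ℕ) x i, i < b → Function.update t (b + 3) x i = t i := by
    intro t x i hi
    rw [Function.update_of_ne (by omega)]
  have e1' : ∀ (t : ℕ → ℕ) x, Function.update t (b + 3) x b = t b := by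
    intro t x
    rw [Function.update_of_ne (by omega)]
  have e2' : ∀ (t : ℕ → ℕ) x, Function.update t (b + 3) x (b + 2) = t (b + 2) := by
    intro t x
    rw [Function.update_of_ne (by omega)]
  simp only [PFun.coe_val, Part.mem_some_iff, List.Vector.ofFn, Fin.cons_zero, Fin.cons_succ,
    setTwo_of_lt hout, setTwo_self, setTwo_succ, Function.update_self,
    e _ _ _ _ (hargs _), e1, e' _ _ _ (hargs _), e1', e2', exists_eq_left]
  refine Nat.mem_rfind.trans ?_
  simp only [Part.coe_some, Part.mem_some_iff, eq_comm (a := true), eq_comm (a := false),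
    decide_eq_true_eq, decide_eq_false_iff_not]
  constructor
  · rintro ⟨h, h'⟩
    refine ⟨s out, fun m => Nat.rec (motive := fun _ => ℕ) 0
      (fun m _ => f (m ::ᵥ List.Vector.ofFn fun i => s (args i)) - 1) m, rfl, fun m hm => ?_,
      rfl, h⟩
    have := h' hm
    simp only
    omega
  · rintro ⟨_, a, -, h', rfl, h⟩
    refine ⟨h, fun {m} hm => ?_⟩
    rw [h' m hm]
    omega

theorem graphTestable_of_primrec {n : ℕ} {f : List.Vector ℕ n → ℕ} (hf : Nat.Primrec' f) :
    GraphTestable (n := n) ↑f := by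
  induction hf with
  | zero =>
    intro b args out _ _ _
    exact (testable_isZero b out).congr fun s _ => by simp
  | succ =>
    intro b args out hargs hout hne
    exact (testable_succ (hne 0).symm hout (hargs 0)).congr fun s _ => by
      simp [List.Vector.ofFn]
  | get i =>
    intro b args out hargs hout hne
    exact (testable_eq (hne i).symm hout (hargs i)).congr fun s _ => by simp
  | comp g _ _ ihf ihg =>
    refine cast (congrArg GraphTestable ?_) (ihf.comp ihg)
    funext v
    simp only [PFun.coe_val, Vector.mOfFn_part_some]
    exact Part.bind_some _ _
  | prec _ _ ihf ihg => exact ihf.prec ihg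

theorem graphTestable_of_partrec {n : ℕ} {f : List.Vector ℕ n →. ℕ} (hf : Nat.Partrec' f) :
    GraphTestable f := by
  induction hf with
  | prim hf => exact graphTestable_of_primrec hf
  | comp g _ _ ihf ihg => exact ihf.comp ihg
  | rfind _ ih => exact ih.rfind

/-- A recursively enumerable set is the set of all `n` for which some program has a run that starts
with `n` in counter `0`, all other counters being zero, and ends with all counters zero. -/
theorem exists_counterProg {S : Set ℕ} (hS : REPred fun n => n ∈ S) :
    ∃ P : CounterProg, ∀ n, n ∈ S ↔ P.Run (Pi.single 0 n) 0 := by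
  let f : ℕ →. ℕ := fun n => (Part.assert (n ∈ S) fun _ => Part.some ()).map fun _ => 0
  have hf : Partrec f := Partrec.map hS (Computable.const 0).to₂
  obtain ⟨P, hP⟩ := ((graphTestable_of_partrec (Nat.Partrec'.part_iff₁.mpr hf)) 2 (fun _ => 0) 1
    (by simp) (by simp) (by simp)).congr (ψ := fun s => s 1 = 0 ∧ s 0 ∈ S) (fun s _ => by
      simp [f, List.Vector.ofFn, and_comm, eq_comm])
  refine ⟨seq P (clear 0), fun n => ?_⟩
  simp only [run_seq, run_clear]
  have hcl : ∀ i, 2 ≤ i → (Pi.single 0 n : ℕ → ℕ) i = 0 := by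
    intro i hi
    simp [show i ≠ 0 by omega]
  have h0 : Function.update (Pi.single 0 n : ℕ → ℕ) 0 0 = 0 := by
    funext i
    by_cases hi : i = 0
    · subst hi; simp
    · simp [hi]
  constructor
  · intro hn
    exact ⟨_, (hP _ hcl _).mpr ⟨rfl, by simp, by simpa using hn⟩, h0.symm⟩
  · rintro ⟨t, ht, -⟩
    simpa using ((hP _ hcl _).mp ht).2.2

/-! ### Petri nets with inhibitor arcs -/

/-- A Petri net with places `P`, transitions `E`, arcs of weight one, and inhibitor arcs. -/
structure Net (P E : Type*) where
  pre : E → P → Bool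
  post : E → P → Bool
  inh : E → P → Bool

/-- Firing one transition. -/
def Net.Step {P E : Type*} (N : Net P E) (c c' : P → ℕ) : Prop :=
  ∃ e, (∀ p, N.inh e p = true → c p = 0) ∧
    ∀ p, c' p + (N.pre e p).toNat = c p + (N.post e p).toNat

/-- The net without the places outside `F`. -/
def Net.restrict {P E : Type*} (N : Net P E) (F : Set P) : Net F E :=
  ⟨fun e p => N.pre e p, fun e p => N.post e p, fun e p => N.inh e p⟩

theorem Net.reach_restrict_iff {P E : Type*} (N : Net P E) (F : Set P)
    (hF : ∀ e, ∀ p ∉ F, N.pre e p = false ∧ N.post e p = false) {c d : P → ℕ}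
    (hc : ∀ p ∉ F, c p = 0) (hd : ∀ p ∉ F, d p = 0) :
    Relation.ReflTransGen (N.restrict F).Step (fun p => c p) (fun p => d p) ↔
      Relation.ReflTransGen N.Step c d := by
  classical
  constructor
  · intro h
    have h' := h.lift (p := N.Step) (fun c p => if h : p ∈ F then c ⟨p, h⟩ else 0) (by
      rintro a b ⟨e, h1, h2⟩
      refine ⟨e, fun p hp => ?_, fun p => ?_⟩
      · by_cases hpF : p ∈ F
        · simpa [hpF] using h1 ⟨p, hpF⟩ hp
        · simp [hpF]
      · by_cases hpF : p ∈ F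
        · simpa [hpF, Net.restrict] using h2 ⟨p, hpF⟩
        · simp [hpF, hF e p hpF])
    convert h' using 1
    · funext p
      by_cases hpF : p ∈ F
      · simp [hpF]
      · simp [hpF, hc p hpF]
    · funext p
      by_cases hpF : p ∈ F
      · simp [hpF]
      · simp [hpF, hd p hpF]
  · intro h
    refine h.lift (p := (N.restrict F).Step) (fun (c : P → ℕ) (p : F) => c p) ?_
    rintro a b ⟨e, h1, h2⟩
    exact ⟨e, fun p hp => h1 p hp, fun p => h2 p⟩

/-- The action on the counters that accompanies a transition between control states. -/
inductive Action where
  | nop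
  | inc (i : ℕ)
  | dec (i : ℕ)
  | isZero (i : ℕ)
  deriving DecidableEq

/-- The effect of an action on the counters; it agrees with that of the atomic program. -/
def Action.Run : Action → (ℕ → ℕ) → (ℕ → ℕ) → Prop
  | nop, s, s' => s' = s
  | inc i, s, s' => s' = s + Pi.single i 1
  | dec i, s, s' => s' + Pi.single i 1 = s
  | isZero i, s, s' => s' = s ∧ s i = 0

/-- The transitions for executing `P` and going on with the list `K` of programs. The control states
are the lists of programs that remain to be executed. -/
def CounterProg.edges : CounterProg → List CounterProg →
    Set (List CounterProg × Action × List CounterProg)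
  | inc i, K => {(inc i :: K, .inc i, K)}
  | dec i, K => {(dec i :: K, .dec i, K)}
  | isZero i, K => {(isZero i :: K, .isZero i, K)}
  | seq P Q, K => {(seq P Q :: K, .nop, P :: Q :: K)} ∪ (P.edges (Q :: K) ∪ Q.edges K)
  | star P, K => {(star P :: K, .nop, K), (star P :: K, .nop, P :: star P :: K)} ∪
      P.edges (star P :: K)

theorem CounterProg.finite_edges (P : CounterProg) (K : List CounterProg) :
    (P.edges K).Finite := by
  induction P generalizing K with
  | inc i => exact Set.finite_singleton _
  | dec i => exact Set.finite_singleton _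
  | isZero i => exact Set.finite_singleton _
  | seq P Q ihP ihQ => exact (Set.finite_singleton _).union ((ihP _).union (ihQ _))
  | star P ih => exact (Set.toFinite _).union (ih _)

/-- The relation computed by executing a list of programs. -/
def ListRun : List CounterProg → (ℕ → ℕ) → (ℕ → ℕ) → Prop
  | [], s, s' => s' = s
  | P :: K, s, s' => ∃ t, P.Run s t ∧ ListRun K t s'

theorem CounterProg.edges_sound {P : CounterProg} {K A B : List CounterProg} {a : Action}
    (h : (A, a, B) ∈ P.edges K) {s t s' : ℕ → ℕ} (ha : a.Run s t) (hB : ListRun B t s') :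
    ListRun A s s' := by
  induction P generalizing K with
  | inc i => cases h; exact ⟨t, ha, hB⟩
  | dec i => cases h; exact ⟨t, ha, hB⟩
  | isZero i => cases h; exact ⟨t, ha, hB⟩
  | seq P Q ihP ihQ =>
    rcases h with h | h | h
    · cases h
      cases ha
      obtain ⟨u, hu, v, hv, hK⟩ := hB
      exact ⟨v, ⟨u, hu, hv⟩, hK⟩
    · exact ihP h
    · exact ihQ h
  | star P ih =>
    rcases h with (h | h) | h
    · cases h
      cases ha
      exact ⟨s, .refl, hB⟩
    · cases h
      cases ha
      obtain ⟨u, hu, v, hv, hK⟩ := hB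
      exact ⟨v, Relation.ReflTransGen.head hu hv, hK⟩
    · exact ih h

/-- A control state is never its own successor, so that a transition does consume its token. -/
theorem CounterProg.edges_ne {P : CounterProg} {K A B : List CounterProg} {a : Action}
    (h : (A, a, B) ∈ P.edges K) : A ≠ [] ∧ A ≠ B := by
  suffices h : A ≠ [] ∧ A.length ≠ B.length from ⟨h.1, fun e => h.2 (e ▸ rfl)⟩
  induction P generalizing K with
  | inc i => cases h; simp
  | dec i => cases h; simp
  | isZero i => cases h; simp
  | seq P Q ihP ihQ =>
    rcases h with h | h | h
    · cases h; simp
    · exact ihP h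
    · exact ihQ h
  | star P ih =>
    rcases h with (h | h) | h
    · cases h; simp
    · cases h; simp
    · exact ih h

/-- One transition between pairs of a control state and counters. -/
def EdgeStep (T : Set (List CounterProg × Action × List CounterProg))
    (x y : List CounterProg × (ℕ → ℕ)) : Prop :=
  ∃ a, (x.1, a, y.1) ∈ T ∧ a.Run x.2 y.2

theorem EdgeStep.mono {T U : Set (List CounterProg × Action × List CounterProg)} (h : T ⊆ U)
    {x y : List CounterProg × (ℕ → ℕ)} (hT : Relation.ReflTransGen (EdgeStep T) x y) :
    Relation.ReflTransGen (EdgeStep U) x y :=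
  Relation.ReflTransGen.mono (r := EdgeStep T) (p := EdgeStep U)
    (fun _ _ ⟨a, ha, hr⟩ => ⟨a, h ha, hr⟩) _ _ hT

theorem CounterProg.edges_complete (P : CounterProg) (K : List CounterProg) {s s' : ℕ → ℕ}
    (h : P.Run s s') : Relation.ReflTransGen (EdgeStep (P.edges K)) (P :: K, s) (K, s') := by
  induction P generalizing K s s' with
  | inc i => exact .single ⟨.inc i, rfl, h⟩
  | dec i => exact .single ⟨.dec i, rfl, h⟩
  | isZero i => exact .single ⟨.isZero i, rfl, h⟩
  | seq P Q ihP ihQ =>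
    obtain ⟨t, hP, hQ⟩ := h
    refine .head (b := (P :: Q :: K, s)) ⟨.nop, .inl rfl, rfl⟩ ?_
    exact (EdgeStep.mono (fun x hx => .inr (.inl hx)) (ihP (Q :: K) hP)).trans
      (EdgeStep.mono (fun x hx => .inr (.inr hx)) (ihQ K hQ))
  | star P ih =>
    have hstar : Relation.ReflTransGen (EdgeStep ((star P).edges K)) (star P :: K, s)
        (star P :: K, s') := by
      induction h with
      | refl => exact .refl
      | @tail t u _ h ih' =>
        refine ih'.trans (.head (b := (P :: star P :: K, t)) ⟨.nop, .inl (.inr rfl), rfl⟩ ?_)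
        exact EdgeStep.mono (fun x hx => .inr hx) (ih (star P :: K) h)
    exact hstar.tail ⟨.nop, .inl (.inl rfl), rfl⟩

theorem CounterProg.reach_edges_iff (P : CounterProg) (s s' : ℕ → ℕ) :
    Relation.ReflTransGen (EdgeStep (P.edges [])) ([P], s) ([], s') ↔ P.Run s s' := by
  constructor
  · intro h
    suffices key : ∀ x, Relation.ReflTransGen (EdgeStep (P.edges [])) x ([], s') →
        ListRun x.1 x.2 s' by
      obtain ⟨t, ht, ht'⟩ := key _ h
      cases ht'
      exact ht
    intro x h
    induction h using Relation.ReflTransGen.head_induction_on with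
    | refl => rfl
    | head h _ ih =>
      obtain ⟨a, ha, hr⟩ := h
      exact edges_sound ha hr ih
  · exact P.edges_complete []

/-- The net of a program: its places are the control states and the counters. There is one token on
the current control state, except that the empty control state bears no token, so that a run to
zero counters ends with no token at all. -/
noncomputable def CounterProg.net (P : CounterProg) :
    Net (List CounterProg ⊕ ℕ) (P.edges []) := by
  classical
  exact
  { pre := fun e => Sum.elim (fun A => decide (A = e.1.1)) fun i => decide (e.1.2.1 = .dec i)
    post := fun e => Sum.elim (fun A => decide (A = e.1.2.2 ∧ A ≠ []))
      fun i => decide (e.1.2.1 = .inc i)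
    inh := fun e => Sum.elim (fun _ => false) fun i => decide (e.1.2.1 = .isZero i) }

open Classical in
/-- The tokens that represent a control state and counters. -/
noncomputable def tokens (x : List CounterProg × (ℕ → ℕ)) : List CounterProg ⊕ ℕ → ℕ :=
  Sum.elim (fun A => (decide (A = x.1 ∧ A ≠ [])).toNat) x.2

theorem Action.run_iff (a : Action) (s s' : ℕ → ℕ) : a.Run s s' ↔
    (∀ i, a = .isZero i → s i = 0) ∧
      ∀ i, s' i + (decide (a = .dec i)).toNat = s i + (decide (a = .inc i)).toNat := by
  cases a with
  | nop => simp [Run, funext_iff]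
  | inc j =>
    simp only [Run, funext_iff]
    simp [Pi.single_apply, Bool.toNat, Bool.cond_decide, eq_comm]
  | dec j =>
    simp only [Run, funext_iff]
    simp [Pi.single_apply, Bool.toNat, Bool.cond_decide, eq_comm]
  | isZero j => simp [Run, funext_iff, and_comm]

theorem CounterProg.net_step_iff (P : CounterProg) (x : List CounterProg × (ℕ → ℕ))
    (c : List CounterProg ⊕ ℕ → ℕ) :
    P.net.Step (tokens x) c ↔ ∃ y, EdgeStep (P.edges []) x y ∧ c = tokens y := by
  classical
  constructor
  · rintro ⟨⟨⟨A, a, B⟩, he⟩, h1, h2⟩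
    obtain ⟨hA, hAB⟩ := edges_ne he
    have hx : A = x.1 := by
      have := h2 (.inl A)
      simp only [net, tokens, Sum.elim_inl, hAB, decide_true, decide_false, hA,
        ne_eq, not_false_eq_true, and_true] at this
      by_contra h
      simp [h] at this
    refine ⟨(B, fun i => c (.inr i)), ⟨a, hx ▸ he, a.run_iff _ _ |>.mpr ⟨fun i hi => ?_,
      fun i => ?_⟩⟩, ?_⟩
    · exact h1 (.inr i) (by simpa [net] using hi)
    · have := h2 (.inr i)
      simpa [net, tokens] using this
    · funext p
      rcases p with C | i
      · have := h2 (.inl C)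
        simp only [net, tokens, Sum.elim_inl, ← hx] at this ⊢
        by_cases hC : C = A
        · subst hC
          simpa [hAB, hA] using this
        · simpa [hC] using this
      · rfl
  · rintro ⟨⟨B, t⟩, ⟨a, he, ha⟩, rfl⟩
    obtain ⟨hA, hAB⟩ := edges_ne he
    obtain ⟨h1, h2⟩ := (a.run_iff _ _).mp ha
    refine ⟨⟨_, he⟩, fun p hp => ?_, fun p => ?_⟩
    · rcases p with C | i
      · simp [net] at hp
      · exact h1 i (by simpa [net] using hp)
    · rcases p with C | i
      · simp only [net, tokens, Sum.elim_inl]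
        by_cases hC : C = x.1
        · subst hC
          simp [hAB, hA]
        · simp [hC]
      · simpa [net, tokens] using h2 i

theorem CounterProg.reach_net_iff (P : CounterProg) (s : ℕ → ℕ) :
    Relation.ReflTransGen P.net.Step (tokens ([P], s)) 0 ↔ P.Run s 0 := by
  have h0 : (0 : List CounterProg ⊕ ℕ → ℕ) = tokens ([], 0) := by
    funext p
    rcases p with A | i
    · simp [tokens]
    · rfl
  rw [← reach_edges_iff]
  constructor
  · intro h
    have key : ∀ c, Relation.ReflTransGen P.net.Step (tokens ([P], s)) c →
        ∃ y, Relation.ReflTransGen (EdgeStep (P.edges [])) ([P], s) y ∧ c = tokens y := by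
      intro c h
      induction h with
      | refl => exact ⟨_, .refl, rfl⟩
      | tail _ h ih =>
        obtain ⟨y, hy, rfl⟩ := ih
        obtain ⟨z, hz, rfl⟩ := (P.net_step_iff _ _).mp h
        exact ⟨z, hy.tail hz, rfl⟩
    obtain ⟨⟨A, t⟩, hy, h⟩ := key _ h
    have hA : A = [] := by
      by_contra hA
      simpa [tokens, hA] using congrFun h (.inl A)
    have ht : t = 0 := funext fun i => (congrFun h (.inr i)).symm
    rwa [hA, ht] at hy
  · intro h
    rw [h0]
    exact h.lift tokens fun x y hxy => (P.net_step_iff _ _).mpr ⟨y, hxy, rfl⟩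

/-- A recursively enumerable set is the set of all `n` such that a finite net can consume all tokens
if it starts with `n` tokens on one place and one token on another one. -/
theorem exists_net {S : Set ℕ} (hS : REPred fun n => n ∈ S) :
    ∃ (Pl E : Type) (_ : Finite Pl) (_ : Finite E) (_ : DecidableEq Pl) (N : Net Pl E) (p₀ p₁ : Pl),
      p₀ ≠ p₁ ∧
      ∀ n, n ∈ S ↔ Relation.ReflTransGen N.Step (Pi.single p₀ n + Pi.single p₁ 1) 0 := by
  classical
  obtain ⟨P, hP⟩ := exists_counterProg hS
  let places : List CounterProg × Action × List CounterProg → Set (List CounterProg ⊕ ℕ) :=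
    fun e => {.inl e.1, .inl e.2.2} ∪ {p | ∃ i, p = .inr i ∧ (e.2.1 = .inc i ∨ e.2.1 = .dec i)}
  have hpl : ∀ e, (places e).Finite := by
    rintro ⟨A, a, B⟩
    refine (Set.toFinite _).union ?_
    cases a with
    | nop => simp
    | inc i => simp
    | dec i => simp
    | isZero i => simp
  let F : Set (List CounterProg ⊕ ℕ) := {.inr 0, .inl [P]} ∪ ⋃ e ∈ P.edges [], places e
  have hF : F.Finite := (Set.toFinite _).union ((P.finite_edges []).biUnion fun e _ => hpl e)
  refine ⟨F, P.edges [], hF, P.finite_edges [], inferInstance, P.net.restrict F,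
    ⟨.inr 0, .inl (.inl rfl)⟩, ⟨.inl [P], .inl (.inr rfl)⟩,
    fun h => Sum.inr_ne_inl (congrArg Subtype.val h), fun n => ?_⟩
  have hout : ∀ e, ∀ p ∉ F, P.net.pre e p = false ∧ P.net.post e p = false := by
    rintro ⟨e, he⟩ p hp
    have hp' : p ∉ places e := fun h => hp (.inr (Set.mem_biUnion he h))
    simp only [places, Set.mem_union, Set.mem_insert_iff, Set.mem_singleton_iff, Set.mem_ofPred_eq,
      not_or] at hp'
    rcases p with A | i
    · simp only [Sum.inl.injEq] at hp'
      simp [net, hp'.1.1, hp'.1.2]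
    · simpa [net, and_comm] using hp'.2
  have e0 : tokens ([P], Pi.single 0 n) = Pi.single (.inr 0) n + Pi.single (.inl [P]) 1 := by
    funext p
    rcases p with A | i
    · by_cases hA : A = [P]
      · subst hA; simp [tokens]
      · simp [tokens, hA]
    · by_cases hi : i = 0
      · subst hi; simp [tokens]
      · simp [tokens, hi]
  rw [hP, ← P.reach_net_iff, ← P.net.reach_restrict_iff F hout, e0]
  · constructor <;> intro h <;> convert h using 1
    all_goals
      funext p
      simp [Pi.single_apply, Subtype.ext_iff]
  · intro p hp
    rw [e0]
    have h1 : p ≠ .inr 0 := fun h => hp (.inl (.inl h))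
    have h2 : p ≠ .inl [P] := fun h => hp (.inl (.inr h))
    simp [h1, h2]
  · intro p _
    rfl

end

section

/-! ### Bitwise addition and blocks of bits -/

/-- The carries of the addition of three bits. -/
def majority (a b c : Bool) : Bool := ((a && b) ^^ ((a ^^ b) && c))

theorem add_eq_xor_add_two_mul_and (a b : ℕ) : a + b = (a ^^^ b) + 2 * (a &&& b) := by
  induction a using Nat.strong_induction_on generalizing b with
  | _ a ih =>
    rcases Nat.eq_zero_or_pos a with rfl | ha
    · simp
    · have h := ih (a / 2) (by omega) (b / 2)
      have h1 : (a ^^^ b) / 2 = a / 2 ^^^ b / 2 := Nat.xor_div_two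
      have h2 : (a &&& b) / 2 = a / 2 &&& b / 2 := Nat.and_div_two
      have h3 : (a ^^^ b) % 2 = (a + b) % 2 := Nat.xor_mod_two_eq
      have h4 : (a &&& b) % 2 = (a % 2) * (b % 2) := by
        rw [Nat.and_mod_two_pow (n := 1) |>.trans rfl]
        rcases Nat.mod_two_eq_zero_or_one a with h | h <;>
          rcases Nat.mod_two_eq_zero_or_one b with h' | h' <;> simp [h, h']
      rcases Nat.mod_two_eq_zero_or_one a with h5 | h5 <;>
        rcases Nat.mod_two_eq_zero_or_one b with h6 | h6 <;>
        simp only [h5, h6] at h4 <;> omega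

/-- The full adder identity at all positions at once. With `c = 2 * m` it says that `c` is the
sequence of carries of the addition of `a` and `b`. -/
theorem full_adder {a b c m : ℕ}
    (hm : ∀ i, m.testBit i = majority (a.testBit i) (b.testBit i) (c.testBit i)) :
    a + b + c = (a ^^^ b ^^^ c) + 2 * m := by
  have h1 := add_eq_xor_add_two_mul_and a b
  have h2 := add_eq_xor_add_two_mul_and (a ^^^ b) c
  have h3 := add_eq_xor_add_two_mul_and (a &&& b) ((a ^^^ b) &&& c)
  have h4 : (a &&& b) &&& ((a ^^^ b) &&& c) = 0 := by
    apply Nat.eq_of_testBit_eq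
    intro i
    simp only [Nat.testBit_and, Nat.testBit_xor, Nat.zero_testBit]
    cases a.testBit i <;> cases b.testBit i <;> rfl
  have h5 : (a &&& b) ^^^ ((a ^^^ b) &&& c) = m := by
    apply Nat.eq_of_testBit_eq
    intro i
    simp [hm, majority]
  rw [h4, h5] at h3
  omega

/-- The majority of the bits of `a`, `b` and `c`, at every position. -/
def majorityNat (a b c : ℕ) : ℕ := (a &&& b) ^^^ ((a ^^^ b) &&& c)

theorem testBit_majorityNat (a b c i : ℕ) : (majorityNat a b c).testBit i =
    majority (a.testBit i) (b.testBit i) (c.testBit i) := by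
  simp [majorityNat, majority]

/-- The sequence of carries of an addition exists: it is the difference, bit by bit, between the sum
with and without carries. -/
theorem exists_carry (a b : ℕ) : ∃ c, c = 2 * majorityNat a b c ∧ a ^^^ b ^^^ c = a + b := by
  refine ⟨a ^^^ b ^^^ (a + b), ?_, by rw [← Nat.xor_assoc, Nat.xor_self, Nat.zero_xor]⟩
  have h := full_adder (testBit_majorityNat a b (a ^^^ b ^^^ (a + b)))
  rw [← Nat.xor_assoc (a ^^^ b) (a ^^^ b), Nat.xor_self, Nat.zero_xor] at h
  omega

theorem testBit_one (i : ℕ) : Nat.testBit 1 i = decide (i = 0) := by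
  rw [Bool.eq_iff_iff, Nat.testBit_one_eq_true_iff_self_eq_zero, decide_eq_true_eq]

/-- Block number `t` of the binary representation of `x`, for blocks of length `L`. -/
def block (L x t : ℕ) : ℕ := x / 2 ^ (L * t) % 2 ^ L

theorem testBit_block (L x t k : ℕ) :
    (block L x t).testBit k = (decide (k < L) && x.testBit (L * t + k)) := by
  rw [block, Nat.testBit_mod_two_pow, Nat.testBit_div_two_pow, Nat.add_comm]

theorem block_zero (L x : ℕ) : block L x 0 = x % 2 ^ L := by simp [block]

theorem block_succ (L x t : ℕ) : block L x (t + 1) = block L (x / 2 ^ L) t := by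
  rw [block, block, Nat.div_div_eq_div_mul, ← pow_add, Nat.mul_succ, Nat.add_comm]

theorem eq_of_block_eq {L x y : ℕ} (hL : 1 ≤ L) (h : ∀ t, block L x t = block L y t) : x = y := by
  apply Nat.eq_of_testBit_eq
  intro i
  have := congrArg (fun a => a.testBit (i % L)) (h (i / L))
  simpa [testBit_block, Nat.mod_lt _ hL, Nat.div_add_mod] using this

theorem block_add {L x y : ℕ} (h : ∀ t, block L x t + block L y t < 2 ^ L) (t : ℕ) :
    block L (x + y) t = block L x t + block L y t := by
  induction t generalizing x y with
  | zero =>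
    have := h 0
    simp only [block_zero] at this ⊢
    rw [Nat.add_mod, Nat.mod_eq_of_lt this]
  | succ t ih =>
    have h0 := h 0
    simp only [block_zero] at h0
    have : (x + y) / 2 ^ L = x / 2 ^ L + y / 2 ^ L := by
      rw [Nat.add_div (by positivity), if_neg (by omega), add_zero]
    rw [block_succ, block_succ, block_succ, this]
    exact ih fun t => by simpa only [block_succ] using h (t + 1)

theorem block_two_pow_mul_add_zero {L x a : ℕ} (ha : a < 2 ^ L) :
    block L (2 ^ L * x + a) 0 = a := by
  rw [block_zero, Nat.mul_add_mod, Nat.mod_eq_of_lt ha]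

theorem block_two_pow_mul_add_succ {L x a : ℕ} (ha : a < 2 ^ L) (t : ℕ) :
    block L (2 ^ L * x + a) (t + 1) = block L x t := by
  rw [block_succ, Nat.mul_add_div (by positivity), Nat.div_eq_of_lt ha, add_zero]

theorem block_of_dvd {L x : ℕ} (hL : 1 ≤ L) (h : ∀ i, x.testBit i = true → L ∣ i) (t : ℕ) :
    block L x t = (x.testBit (L * t)).toNat := by
  apply Nat.eq_of_testBit_eq
  intro k
  rw [testBit_block, Nat.testBit_bool_toNat]
  rcases Nat.eq_zero_or_pos k with rfl | hk
  · simp [show 0 < L from hL]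
  · by_cases hkL : k < L
    · have : x.testBit (L * t + k) = false := by
        by_contra hx
        have := h _ (by simpa using hx)
        rw [Nat.dvd_add_right (Nat.dvd_mul_right _ _)] at this
        exact absurd (Nat.le_of_dvd hk this) (by omega)
      simp [this, hk.ne']
    · simp [hkL, hk.ne']

/-! ### Tableaux of net computations -/

/-- The numbers that make up the tableau of a computation of length `T` of a net, each with a block
of `L` bits for every point of time. -/
inductive Var (P E : Type)
  /-- The input. -/
  | inp
  /-- The number `1`. -/
  | one
  /-- A bit at the beginning of each of the blocks `0, …, T - 1`. -/
  | mark
  /-- `mark`, one block up. -/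
  | zmark
  /-- All bits of the blocks `0, …, T - 1`. -/
  | full
  /-- `full`, one bit up. -/
  | dfull
  /-- `full`, one block up. -/
  | zfull
  /-- A bit at the beginning of each block where `e` fires. -/
  | ev (e : E)
  /-- All bits of each block where `e` fires. -/
  | fill (e : E)
  /-- `fill e`, one bit up. -/
  | dfill (e : E)
  /-- The numbers of tokens on `p`, block by block. -/
  | reg (p : P)
  /-- `reg p`, one bit up. -/
  | dreg (p : P)
  /-- The numbers of tokens on `p` after the next firing, block by block. -/
  | nxt (p : P)
  /-- `nxt p`, one block up. -/
  | znxt (p : P)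
  /-- A bit at the beginning of each block where `p` receives a token. -/
  | inc (p : P)
  /-- A bit at the beginning of each block where a token is taken from `p`. -/
  | dec (p : P)
  /-- The carries that arise in adding `inc p` to `reg p`. -/
  | maj₁ (p : P)
  /-- `maj₁ p`, one bit up. -/
  | car₁ (p : P)
  /-- The carries that arise in adding `dec p` to `nxt p`. -/
  | maj₂ (p : P)
  /-- `maj₂ p`, one bit up. -/
  | car₂ (p : P)
  deriving Fintype

variable {P E : Type}

/-- The pairs of numbers of a tableau where the second one is the first one moved up by one bit. -/
def Var.doubled : Var P E → Option (Var P E)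
  | full => some dfull
  | fill e => some (dfill e)
  | reg p => some (dreg p)
  | maj₁ p => some (car₁ p)
  | maj₂ p => some (car₂ p)
  | _ => none

/-- The pairs of numbers of a tableau where the second one is the first one moved up by one
block. -/
def Var.shifted : Var P E → Option (Var P E)
  | mark => some zmark
  | full => some zfull
  | nxt p => some (znxt p)
  | _ => none

/-- A bit of the initial number of tokens on `p`. -/
def initBit [DecidableEq P] (p₀ p₁ p : P) (b : Var P E → Bool) : Bool :=
  if p = p₀ then b .inp else if p = p₁ then b .one else false

/-- The conditions on the bits of a tableau at a single position. -/
structure Net.BitsOK [DecidableEq P] (N : Net P E) (p₀ p₁ : P) (b : Var P E → Bool) : Prop where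
  one : b .one = (b .mark && !b .zmark)
  full : b .full = (b .mark || (b .dfull && !b .zmark))
  inp : b .inp = true → b .full = true ∧ b .zfull = false
  mark_of_ev : ∀ e, b (.ev e) = true → b .mark = true
  exists_ev : b .mark = true → ∃ e, b (.ev e) = true
  ev_unique : ∀ e e', b (.ev e) = true → b (.ev e') = true → e = e'
  fill : ∀ e, b (.fill e) = (b (.ev e) || (b (.dfill e) && !b .mark && !b .zmark))
  reg_full : ∀ p, b (.reg p) = true → b .full = true
  dreg : ∀ p, b (.dreg p) = true → b .mark = false ∧ b .zmark = false
  reg : ∀ p, b (.reg p) = (b (.znxt p) ^^ initBit p₀ p₁ p b)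
  init : ∀ p, (b (.znxt p) && initBit p₀ p₁ p b) = false
  inc : ∀ p, b (.inc p) = true ↔ ∃ e, b (.ev e) = true ∧ N.post e p = true
  dec : ∀ p, b (.dec p) = true ↔ ∃ e, b (.ev e) = true ∧ N.pre e p = true
  maj₁ : ∀ p, b (.maj₁ p) = majority (b (.reg p)) (b (.inc p)) (b (.car₁ p))
  maj₂ : ∀ p, b (.maj₂ p) = majority (b (.nxt p)) (b (.dec p)) (b (.car₂ p))
  sum : ∀ p, (b (.reg p) ^^ b (.inc p) ^^ b (.car₁ p)) = (b (.nxt p) ^^ b (.dec p) ^^ b (.car₂ p))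
  inh : ∀ e p, N.inh e p = true → b (.fill e) = true → b (.reg p) = false

theorem Net.bitsOK_false [DecidableEq P] (N : Net P E) (p₀ p₁ : P) :
    N.BitsOK p₀ p₁ fun _ => false := by
  constructor <;> simp [initBit, majority]

/-- The numbers `v` form a tableau of a computation of `N`, for blocks of length `L`. -/
structure Net.IsTableau [DecidableEq P] (N : Net P E) (p₀ p₁ : P) (L : ℕ) (v : Var P E → ℕ) :
    Prop where
  bits : ∀ i, N.BitsOK p₀ p₁ fun x => (v x).testBit i
  double : ∀ x y, x.doubled = some y → v y = 2 * v x
  shift : ∀ x y, x.shifted = some y → v y = 2 ^ L * v x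

variable [DecidableEq P] {N : Net P E} {p₀ p₁ : P} {L : ℕ} {v : Var P E → ℕ}

theorem Net.IsTableau.testBit_shifted (h : N.IsTableau p₀ p₁ L v) {x y : Var P E}
    (hxy : x.shifted = some y) (i : ℕ) :
    (v y).testBit i = (decide (L ≤ i) && (v x).testBit (i - L)) := by
  rw [h.shift x y hxy, Nat.testBit_two_pow_mul]

theorem Net.IsTableau.testBit_doubled (h : N.IsTableau p₀ p₁ L v) {x y : Var P E}
    (hxy : x.doubled = some y) (i : ℕ) : (v y).testBit (i + 1) = (v x).testBit i := by
  rw [h.double x y hxy, Nat.testBit_succ, Nat.mul_div_cancel_left _ (by norm_num)]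

/-- Each bit of `mark` other than the lowest has another bit of `mark` one block below. -/
theorem Net.IsTableau.mark_sub (h : N.IsTableau p₀ p₁ L v) (h1 : v .one = 1) {i : ℕ}
    (hi : (v .mark).testBit i = true) : i = 0 ∨ (L ≤ i ∧ (v .mark).testBit (i - L) = true) := by
  have hone := (h.bits i).one
  have hz := h.testBit_shifted (x := .mark) rfl i
  rw [h1, testBit_one, hi] at hone
  by_cases h0 : i = 0
  · exact .inl h0
  · rw [hz] at hone
    simpa [h0] using hone

theorem Net.IsTableau.dvd_of_mark (h : N.IsTableau p₀ p₁ L v) (h1 : v .one = 1) (hL : 1 ≤ L) {i : ℕ}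
    (hi : (v .mark).testBit i = true) : L ∣ i := by
  induction i using Nat.strong_induction_on with
  | _ i ih =>
    rcases h.mark_sub h1 hi with rfl | ⟨hLi, hi'⟩
    · exact dvd_zero _
    · exact (Nat.dvd_sub_iff_left hLi dvd_rfl).mp (ih _ (by omega) hi')

/-- The marks form an initial segment of the multiples of `L`, since `mark` loses only the bit at
position `0` when the marks that are one block above another one are deleted. -/
theorem Net.IsTableau.exists_length (h : N.IsTableau p₀ p₁ L v) (h1 : v .one = 1) (hL : 1 ≤ L) :
    ∃ T, 1 ≤ T ∧ ∀ t, (v .mark).testBit (L * t) = true ↔ t < T := by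
  classical
  have hex : ∃ t, (v .mark).testBit (L * t) = false := by
    refine ⟨v .mark, Nat.testBit_eq_false_of_lt (Nat.lt_two_pow_self.trans_le
      (Nat.pow_le_pow_right (by norm_num) (Nat.le_mul_of_pos_left _ hL)))⟩
  have h0 : (v .mark).testBit 0 = true := by
    have := (h.bits 0).one
    rw [h1, testBit_one] at this
    simp only [decide_true] at this
    exact ((Bool.and_eq_true_iff).mp this.symm).1
  refine ⟨Nat.find hex, ?_, fun t => ⟨fun ht => ?_, fun ht => ?_⟩⟩
  · rw [Nat.one_le_iff_ne_zero]
    intro h2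
    have := Nat.find_spec hex
    rw [h2, mul_zero, h0] at this
    cases this
  · by_contra hlt
    have down : ∀ d, (v .mark).testBit (L * (Nat.find hex + d)) = false := by
      intro d
      induction d with
      | zero => exact Nat.find_spec hex
      | succ d ih =>
        by_contra hd
        rcases h.mark_sub h1 (by simpa using hd) with h2 | ⟨-, h2⟩
        · have : 0 < L * (Nat.find hex + (d + 1)) := by positivity
          omega
        · rw [← Nat.add_assoc, Nat.mul_succ, Nat.add_sub_cancel, ih] at h2
          cases h2
    have := down (t - Nat.find hex)
    rw [Nat.add_sub_cancel' (not_lt.mp hlt), ht] at this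
    cases this
  · simpa using Nat.find_min hex ht

theorem Net.IsTableau.full_iff (h : N.IsTableau p₀ p₁ L v) (h1 : v .one = 1) (hL : 1 ≤ L) {T : ℕ}
    (hT : 1 ≤ T) (hmark : ∀ t, (v .mark).testBit (L * t) = true ↔ t < T) (i : ℕ) :
    (v .full).testBit i = true ↔ i < L * T := by
  have hpos : 0 < L * T := by positivity
  induction i with
  | zero =>
    have h0 : (v .mark).testBit 0 = true := by simpa using (hmark 0).mpr hT
    rw [(h.bits 0).full]
    simp [h0, hpos]
  | succ i ih =>
    have hf := (h.bits (i + 1)).full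
    have hz := h.testBit_shifted (x := .mark) rfl (i + 1)
    rw [h.testBit_doubled (x := .full) rfl] at hf
    have ih' : (v .full).testBit i = true ↔ i < L * T := ih
    rw [hf, Bool.or_eq_true, Bool.and_eq_true, ih', Bool.not_eq_true', hz]
    by_cases hd : L ∣ i + 1
    · obtain ⟨t, ht⟩ := hd
      obtain ⟨t, rfl⟩ : ∃ s, t = s + 1 := ⟨t - 1, by
        rcases t with _ | t
        · omega
        · omega⟩
      have hle : L ≤ L * (t + 1) := Nat.le_mul_of_pos_right _ (by omega)
      have hlt : L * (t + 1) < L * T ↔ t + 1 < T := Nat.mul_lt_mul_left hL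
      rw [ht, hmark, hlt, show L * (t + 1) - L = L * t by rw [Nat.mul_succ]; omega]
      have hm := hmark t
      constructor
      · rintro (h2 | ⟨h2, h3⟩)
        · exact h2
        · have h4 : ¬ t < T := by
            rw [← hm]
            simpa [hle] using h3
          have : L * T ≤ L * t := Nat.mul_le_mul_left _ (not_lt.mp h4)
          have : L * (t + 1) = L * t + L := Nat.mul_succ _ _
          omega
      · exact .inl
    · have h2 : (v .mark).testBit (i + 1) = false := by
        by_contra h2
        exact hd (h.dvd_of_mark h1 hL (by simpa using h2))
      have h3 : (decide (L ≤ i + 1) && (v .mark).testBit (i + 1 - L)) = false := by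
        by_contra h3
        simp only [Bool.not_eq_false, Bool.and_eq_true, decide_eq_true_eq] at h3
        have := h.dvd_of_mark h1 hL h3.2
        exact hd ((Nat.dvd_sub_iff_left h3.1 dvd_rfl).mp this)
      have h4 : i + 1 ≠ L * T := fun e => hd (e ▸ Dvd.intro _ rfl)
      simp only [h2, h3, Bool.false_eq_true, false_or, and_true]
      omega

/-- The recursion for `fill e` copies a bit of `ev e` upwards until the next mark. -/
theorem Net.IsTableau.fill_of_ev (h : N.IsTableau p₀ p₁ L v) (h1 : v .one = 1) (hL : 1 ≤ L)
    {e : E} {t : ℕ} (he : (v (.ev e)).testBit (L * t) = true) (k : ℕ) (hk : k < L) :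
    (v (.fill e)).testBit (L * t + k) = true := by
  induction k with
  | zero =>
    rw [add_zero, (h.bits (L * t)).fill]
    simp [he]
  | succ k ih =>
    have hd : ¬ L ∣ L * t + (k + 1) := by
      rw [Nat.dvd_add_right (Nat.dvd_mul_right _ _)]
      exact fun hd => absurd (Nat.le_of_dvd (by omega) hd) (by omega)
    have h2 : (v .mark).testBit (L * t + (k + 1)) = false := by
      by_contra h2
      exact hd (h.dvd_of_mark h1 hL (by simpa using h2))
    have h3 : (v .zmark).testBit (L * t + (k + 1)) = false := by
      rw [h.testBit_shifted (x := .mark) rfl]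
      by_contra h3
      simp only [Bool.not_eq_false, Bool.and_eq_true, decide_eq_true_eq] at h3
      exact hd ((Nat.dvd_sub_iff_left h3.1 dvd_rfl).mp (h.dvd_of_mark h1 hL h3.2))
    rw [(h.bits (L * t + (k + 1))).fill]
    simp only [h2, h3]
    rw [← Nat.add_assoc, h.testBit_doubled (x := .fill e) rfl, ih (by omega)]
    simp

/-- The initial number of tokens on `p`, for the input `n`. -/
def initTokens (p₀ p₁ : P) (n : ℕ) : P → ℕ := fun p => if p = p₀ then n else if p = p₁ then 1 else 0

theorem testBit_initTokens (v : Var P E → ℕ) (h1 : v .one = 1) (p : P) (i : ℕ) :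
    (initTokens p₀ p₁ (v .inp) p).testBit i = initBit p₀ p₁ p fun x => (v x).testBit i := by
  simp only [initTokens, initBit, h1]
  split_ifs <;> simp

/-- A tableau yields a computation: the contents of `p` at time `t` are block `t` of `reg p`. -/
theorem Net.IsTableau.reach (h : N.IsTableau p₀ p₁ L v) (h1 : v .one = 1) (hL : 1 ≤ L) :
    Relation.ReflTransGen N.Step (initTokens p₀ p₁ (v .inp)) 0 := by
  obtain ⟨T, hT, hmark⟩ := h.exists_length h1 hL
  have hfull := h.full_iff h1 hL hT hmark
  have hp : 2 ^ L = 2 * 2 ^ (L - 1) := by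
    rw [← pow_succ', Nat.sub_add_cancel hL]
  have hp1 : 1 ≤ 2 ^ (L - 1) := Nat.one_le_two_pow
  -- The leading bit of each block of `reg p` is zero, so that no addition overflows.
  have hreg : ∀ p t, block L (v (.reg p)) t < 2 ^ (L - 1) := by
    intro p t
    refine Nat.lt_pow_two_of_testBit _ fun i hi => ?_
    rw [testBit_block]
    by_cases hiL : i < L
    · have hi' : L * t + i + 1 = L * (t + 1) := by rw [Nat.mul_succ]; omega
      by_contra hb
      simp only [hiL, decide_true, Bool.true_and, Bool.not_eq_false] at hb
      have h2 : t < T := by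
        have := (hfull _).mp ((h.bits _).reg_full p hb)
        by_contra h2
        have : L * T ≤ L * t := Nat.mul_le_mul_left _ (not_lt.mp h2)
        omega
      have h3 := ((h.bits (L * t + i + 1)).dreg p
        ((h.testBit_doubled (x := .reg p) rfl _).trans hb)).2
      rw [h.testBit_shifted (x := .mark) rfl, hi', Nat.mul_succ, Nat.add_sub_cancel,
        (hmark t).mpr h2] at h3
      simp at h3
    · simp [hiL]
  have hinit : ∀ p, initTokens p₀ p₁ (v .inp) p < 2 ^ L := by
    intro p
    refine Nat.lt_pow_two_of_testBit _ fun i hi => ?_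
    rw [testBit_initTokens v h1]
    simp only [initBit]
    split_ifs
    · by_contra hb
      obtain ⟨h2, h3⟩ := (h.bits i).inp (by simpa using hb)
      rw [h.testBit_shifted (x := .full) rfl, (hfull _).mpr (by have := (hfull _).mp h2; omega)]
        at h3
      simp [hi] at h3
    · rw [h1, testBit_one, decide_eq_false]
      omega
    · rfl
  have hnext : ∀ p, v (.reg p) = 2 ^ L * v (.nxt p) + initTokens p₀ p₁ (v .inp) p := by
    intro p
    have e := add_eq_xor_add_two_mul_and (v (.znxt p)) (initTokens p₀ p₁ (v .inp) p)
    have e1 : v (.znxt p) &&& initTokens p₀ p₁ (v .inp) p = 0 := by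
      apply Nat.eq_of_testBit_eq
      intro i
      rw [Nat.testBit_and, testBit_initTokens v h1, Nat.zero_testBit]
      exact (h.bits i).init p
    have e2 : v (.znxt p) ^^^ initTokens p₀ p₁ (v .inp) p = v (.reg p) := by
      apply Nat.eq_of_testBit_eq
      intro i
      rw [Nat.testBit_xor, testBit_initTokens v h1]
      exact ((h.bits i).reg p).symm
    rw [← h.shift (.nxt p) (.znxt p) rfl, e, e1, e2, mul_zero, add_zero]
  have hsum : ∀ p, v (.reg p) + v (.inc p) = v (.nxt p) + v (.dec p) := by
    intro p
    have a1 := full_adder fun i => (h.bits i).maj₁ p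
    have a2 := full_adder fun i => (h.bits i).maj₂ p
    rw [← h.double (.maj₁ p) (.car₁ p) rfl] at a1
    rw [← h.double (.maj₂ p) (.car₂ p) rfl] at a2
    rw [Nat.add_right_cancel a1, Nat.add_right_cancel a2]
    apply Nat.eq_of_testBit_eq
    intro i
    simpa only [Nat.testBit_xor] using (h.bits i).sum p
  have hinc : ∀ p t, block L (v (.inc p)) t = ((v (.inc p)).testBit (L * t)).toNat := by
    intro p
    refine block_of_dvd hL fun i hi => ?_
    obtain ⟨e, he, -⟩ := ((h.bits i).inc p).mp hi
    exact h.dvd_of_mark h1 hL ((h.bits i).mark_of_ev e he)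
  have hdec : ∀ p t, block L (v (.dec p)) t = ((v (.dec p)).testBit (L * t)).toNat := by
    intro p
    refine block_of_dvd hL fun i hi => ?_
    obtain ⟨e, he, -⟩ := ((h.bits i).dec p).mp hi
    exact h.dvd_of_mark h1 hL ((h.bits i).mark_of_ev e he)
  have hstep : ∀ p t, block L (v (.reg p)) (t + 1) + ((v (.dec p)).testBit (L * t)).toNat =
      block L (v (.reg p)) t + ((v (.inc p)).testBit (L * t)).toNat := by
    intro p t
    have hn : ∀ t, block L (v (.reg p)) (t + 1) = block L (v (.nxt p)) t := fun t => by
      rw [hnext, block_two_pow_mul_add_succ (hinit p)]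
    have b1 := block_add (L := L) (x := v (.reg p)) (y := v (.inc p)) (fun t => by
      have := hreg p t
      have := Bool.toNat_le ((v (.inc p)).testBit (L * t))
      rw [hinc]; omega) t
    have b2 := block_add (L := L) (x := v (.nxt p)) (y := v (.dec p)) (fun t => by
      have := hreg p (t + 1)
      have := Bool.toNat_le ((v (.dec p)).testBit (L * t))
      rw [hdec, ← hn]; omega) t
    rw [hn, ← hdec, ← hinc, ← b1, ← b2, hsum]
  have hstart : initTokens p₀ p₁ (v .inp) = fun p => block L (v (.reg p)) 0 := by
    funext p
    rw [hnext, block_two_pow_mul_add_zero (hinit p)]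
  have hend : (0 : P → ℕ) = fun p => block L (v (.reg p)) T := by
    funext p
    apply Nat.eq_of_testBit_eq
    intro i
    rw [testBit_block, Pi.zero_apply, Nat.zero_testBit, eq_comm, Bool.and_eq_false_iff]
    refine .inr ?_
    by_contra hb
    have := (hfull _).mp ((h.bits _).reg_full p (by simpa using hb))
    omega
  have key : ∀ t ≤ T, Relation.ReflTransGen N.Step (fun p => block L (v (.reg p)) 0)
      fun p => block L (v (.reg p)) t := by
    intro t
    induction t with
    | zero => exact fun _ => .refl
    | succ t ih =>
      intro ht
      refine (ih (by omega)).tail ?_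
      obtain ⟨e, he⟩ := (h.bits (L * t)).exists_ev ((hmark t).mpr ht)
      have huniq : ∀ q : E → Bool, (∃ e', (v (.ev e')).testBit (L * t) = true ∧ q e' = true) ↔
          q e = true := fun q =>
        ⟨fun ⟨e', h2, h3⟩ => (h.bits (L * t)).ev_unique e' e h2 he ▸ h3, fun h2 => ⟨e, he, h2⟩⟩
      refine ⟨e, fun p hp => ?_, fun p => ?_⟩
      · apply Nat.eq_of_testBit_eq
        intro k
        rw [testBit_block, Nat.zero_testBit]
        by_cases hk : k < L
        · have := (h.bits (L * t + k)).inh e p hp (h.fill_of_ev h1 hL he k hk)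
          simp [this]
        · simp [hk]
      · have e1 : N.post e p = (v (.inc p)).testBit (L * t) := by
          rw [Bool.eq_iff_iff, ← huniq fun e => N.post e p]
          exact ((h.bits (L * t)).inc p).symm
        have e2 : N.pre e p = (v (.dec p)).testBit (L * t) := by
          rw [Bool.eq_iff_iff, ← huniq fun e => N.pre e p]
          exact ((h.bits (L * t)).dec p).symm
        rw [e1, e2]
        exact hstep p t
  rw [hstart, hend]
  exact key T le_rfl

end

section

/-- The number whose bit `k` of block `t` is `f t k`, for the blocks `t < T`. -/
def tab (L T : ℕ) (f : ℕ → ℕ → Bool) : ℕ := Nat.ofBits (n := L * T) fun i => f (i / L) (i % L)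

theorem testBit_tab {L T t k : ℕ} (f : ℕ → ℕ → Bool) (hk : k < L) :
    (tab L T f).testBit (L * t + k) = (decide (t < T) && f t k) := by
  have hL : 0 < L := by omega
  have hlt : L * t + k < L * T ↔ t < T := by
    constructor
    · intro h
      by_contra h'
      have := Nat.mul_le_mul_left L (not_lt.mp h')
      omega
    · intro h
      have := Nat.mul_le_mul_left L (Nat.succ_le_of_lt h)
      rw [Nat.mul_succ] at this
      omega
  rw [tab, Nat.testBit_ofBits]
  split_ifs with h
  · simp [hlt.mp h, Nat.mul_add_div hL, Nat.div_eq_of_lt hk, Nat.mod_eq_of_lt hk]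
  · simp [mt hlt.mpr h]

theorem testBit_shift_block (L t k x : ℕ) :
    (2 ^ L * x).testBit (L * t + k) =
      if t = 0 then decide (L ≤ k) && x.testBit (k - L) else x.testBit (L * (t - 1) + k) := by
  rw [Nat.testBit_two_pow_mul]
  rcases t with _ | t
  · simp
  · have : L * (t + 1) + k - L = L * t + k := by rw [Nat.mul_succ]; omega
    have h : L ≤ L * (t + 1) + k := by rw [Nat.mul_succ]; omega
    simp [this, h]

theorem testBit_double_block {L : ℕ} (hL : 1 ≤ L) (t k x : ℕ) :
    (2 * x).testBit (L * t + k) =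
      if k = 0 then !decide (t = 0) && x.testBit (L * (t - 1) + (L - 1))
      else x.testBit (L * t + (k - 1)) := by
  rcases k with _ | k
  · rcases t with _ | t
    · simp
    · have : L * (t + 1) + 0 = L * t + (L - 1) + 1 := by rw [Nat.mul_succ]; omega
      rw [this, Nat.testBit_succ, Nat.mul_div_cancel_left _ (by norm_num)]
      simp
  · rw [← Nat.add_assoc, Nat.testBit_succ, Nat.mul_div_cancel_left _ (by norm_num)]
    simp

variable {P E : Type} {N : Net P E}

/-- A computation as a sequence of token distributions, continued by zeros after its end. -/
theorem Net.exists_run [Nonempty E] {c : P → ℕ} (h : Relation.ReflTransGen N.Step c 0) :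
    ∃ (T : ℕ) (C : ℕ → P → ℕ) (e : ℕ → E), C 0 = c ∧ (∀ t ≥ T, C t = 0) ∧ ∀ t < T,
      (∀ p, N.inh (e t) p = true → C t p = 0) ∧
      ∀ p, C (t + 1) p + (N.pre (e t) p).toNat = C t p + (N.post (e t) p).toNat := by
  induction h using Relation.ReflTransGen.head_induction_on with
  | refl => exact ⟨0, fun _ => 0, fun _ => Classical.arbitrary E, rfl, fun _ _ => rfl, by simp⟩
  | @head a b h _ ih =>
    obtain ⟨T, C, e, h0, hT, hs⟩ := ih
    obtain ⟨e₀, he, he'⟩ := h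
    refine ⟨T + 1, fun t => t.casesOn a C, fun t => t.casesOn e₀ e, rfl, fun t ht => ?_,
      fun t ht => ?_⟩
    · obtain ⟨t, rfl⟩ : ∃ s, t = s + 1 := ⟨t - 1, by omega⟩
      exact hT t (by omega)
    · rcases t with _ | t
      · refine ⟨he, fun p => ?_⟩
        show C 0 p + _ = _
        rw [h0]
        exact he' p
      · exact hs t (by omega)

theorem exists_tokens_bound [Finite P] {T : ℕ} {C : ℕ → P → ℕ} (hT : ∀ t ≥ T, C t = 0) :
    ∃ m, ∀ t p, C t p < 2 ^ m := by
  cases nonempty_fintype P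
  refine ⟨∑ t ∈ Finset.range T, ∑ p, C t p, fun t p => ?_⟩
  rcases lt_or_ge t T with h | h
  · have h1 := Finset.single_le_sum (f := fun p => C t p) (fun _ _ => Nat.zero_le _)
      (Finset.mem_univ p)
    have h2 := Finset.single_le_sum (f := fun t => ∑ p, C t p) (fun _ _ => Nat.zero_le _)
      (Finset.mem_range.mpr h)
    exact Nat.lt_two_pow_self.trans_le (Nat.pow_le_pow_right (by norm_num) (h1.trans h2))
  · rw [hT t h]
    exact Nat.two_pow_pos _

/-- A computation that removes all tokens yields tableaux, for all sufficiently large block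
lengths. -/
theorem Net.exists_tableau [Finite P] [DecidableEq P] {p₀ p₁ : P} (hp : p₀ ≠ p₁) {n : ℕ}
    (h : Relation.ReflTransGen N.Step (initTokens p₀ p₁ n) 0) :
    ∃ L₀, ∀ L ≥ L₀, ∃ v : Var P E → ℕ, N.IsTableau p₀ p₁ L v ∧ v .one = 1 ∧ v .inp = n := by
  classical
  have hne : initTokens p₀ p₁ n ≠ 0 := fun h0 => by
    simpa [initTokens, hp.symm] using congrFun h0 p₁
  have hE : Nonempty E := by
    rcases h.cases_head with h0 | ⟨_, ⟨e, -⟩, -⟩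
    · exact absurd h0 hne
    · exact ⟨e⟩
  obtain ⟨T, C, e, h0, hCT, hstep⟩ := Net.exists_run h
  have hT : 0 < T := by
    rw [Nat.pos_iff_ne_zero]
    rintro rfl
    exact hne (h0 ▸ hCT 0 le_rfl)
  obtain ⟨m, hm⟩ := exists_tokens_bound hCT
  refine ⟨m + 1, fun L hL => ?_⟩
  have hL1 : 1 ≤ L := by omega
  have hC : ∀ t p k, L ≤ k + 1 → (C t p).testBit k = false := fun t p k hk =>
    Nat.testBit_eq_false_of_lt ((hm t p).trans_le (Nat.pow_le_pow_right (by norm_num) (by omega)))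
  have hCL : ∀ t p, C t p + 1 < 2 ^ L := by
    intro t p
    have h1 := hm t p
    have h2 : 2 ^ (m + 1) ≤ 2 ^ L := Nat.pow_le_pow_right (by norm_num) hL
    have h3 := Nat.one_le_two_pow (n := m)
    rw [Nat.pow_succ] at h2
    omega
  -- Blocks from `T` on need no attention for `reg` and `nxt`, as there are no tokens then.
  have hCt : ∀ t p k, (decide (t < T) && (C t p).testBit k) = (C t p).testBit k := by
    intro t p k
    by_cases h : t < T
    · simp [h]
    · simp [h, hCT t (not_lt.mp h)]
  have hCt' : ∀ t p k, (decide (t < T) && (C (t + 1) p).testBit k) = (C (t + 1) p).testBit k := by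
    intro t p k
    by_cases h : t < T
    · simp [h]
    · simp [h, hCT (t + 1) (by omega)]
  let reg : P → ℕ := fun p => tab L T fun t k => (C t p).testBit k
  let nxt : P → ℕ := fun p => tab L T fun t k => (C (t + 1) p).testBit k
  let inc : P → ℕ := fun p => tab L T fun t k => decide (k = 0) && N.post (e t) p
  let dec : P → ℕ := fun p => tab L T fun t k => decide (k = 0) && N.pre (e t) p
  let mark : ℕ := tab L T fun _ k => decide (k = 0)
  let full : ℕ := tab L T fun _ _ => true
  let ev : E → ℕ := fun a => tab L T fun t k => decide (k = 0) && decide (e t = a)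
  let fill : E → ℕ := fun a => tab L T fun t _ => decide (e t = a)
  have hsum : ∀ p, reg p + inc p = nxt p + dec p := by
    intro p
    have b1 : ∀ t, block L (reg p) t = C t p := by
      intro t
      apply Nat.eq_of_testBit_eq
      intro k
      rw [testBit_block]
      by_cases hk : k < L
      · rw [testBit_tab _ hk, hCt]
        simp [hk]
      · simp [hk, hC t p k (by omega)]
    have b2 : ∀ t, block L (nxt p) t = C (t + 1) p := by
      intro t
      apply Nat.eq_of_testBit_eq
      intro k
      rw [testBit_block]
      by_cases hk : k < L
      · rw [testBit_tab _ hk, hCt']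
        simp [hk]
      · simp [hk, hC (t + 1) p k (by omega)]
    have b3 : ∀ (f : ℕ → Bool) t, block L (tab L T fun t k => decide (k = 0) && f t) t =
        (decide (t < T) && f t).toNat := by
      intro f t
      apply Nat.eq_of_testBit_eq
      intro k
      rw [testBit_block, Nat.testBit_bool_toNat]
      by_cases hk : k < L
      · rw [testBit_tab _ hk]
        by_cases hk0 : k = 0 <;> simp [hk, hk0]
        omega
      · simp [hk, show k ≠ 0 by omega]
    apply eq_of_block_eq hL1
    intro t
    rw [block_add, block_add, b1, b2, b3, b3]
    · by_cases h : t < T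
      · simpa [h] using ((hstep t h).2 p).symm
      · simp [h, hCT t (not_lt.mp h), hCT (t + 1) (by omega)]
    · intro t
      rw [b2, b3]
      have := hCL (t + 1) p
      have := Bool.toNat_le (decide (t < T) && N.pre (e t) p)
      omega
    · intro t
      rw [b1, b3]
      have := hCL t p
      have := Bool.toNat_le (decide (t < T) && N.post (e t) p)
      omega
  choose car₁ hcar₁ hcar₁' using fun p => exists_carry (reg p) (inc p)
  choose car₂ hcar₂ hcar₂' using fun p => exists_carry (nxt p) (dec p)
  let v : Var P E → ℕ := fun
    | .inp => n
    | .one => 1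
    | .mark => mark
    | .zmark => 2 ^ L * mark
    | .full => full
    | .dfull => 2 * full
    | .zfull => 2 ^ L * full
    | .ev a => ev a
    | .fill a => fill a
    | .dfill a => 2 * fill a
    | .reg p => reg p
    | .dreg p => 2 * reg p
    | .nxt p => nxt p
    | .znxt p => 2 ^ L * nxt p
    | .inc p => inc p
    | .dec p => dec p
    | .maj₁ p => majorityNat (reg p) (inc p) (car₁ p)
    | .car₁ p => car₁ p
    | .maj₂ p => majorityNat (nxt p) (dec p) (car₂ p)
    | .car₂ p => car₂ p
  refine ⟨v, ⟨fun i => ?_, ?_, ?_⟩, rfl, rfl⟩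
  · obtain ⟨t, k, hk, rfl⟩ : ∃ t k, k < L ∧ i = L * t + k :=
      ⟨i / L, i % L, Nat.mod_lt _ hL1, (Nat.div_add_mod i L).symm⟩
    have hk1 : k - 1 < L := by omega
    have hL1' : L - 1 < L := by omega
    have hLk : ¬ L ≤ k := by omega
    have hinit : ∀ p, initBit p₀ p₁ p (fun x => (v x).testBit (L * t + k)) =
        (decide (t = 0) && (C 0 p).testBit k) := by
      intro p
      rw [← testBit_initTokens v rfl, show v .inp = n from rfl, ← h0]
      by_cases ht : t = 0
      · simp [ht]
      · have : L ≤ L * t := Nat.le_mul_of_pos_right _ (Nat.pos_of_ne_zero ht)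
        rw [hC 0 p _ (by omega)]
        simp [ht]
    have hmark : mark.testBit (L * t + k) = (decide (t < T) && decide (k = 0)) := testBit_tab _ hk
    have hzmark : (2 ^ L * mark).testBit (L * t + k) =
        (!decide (t = 0) && (decide (t - 1 < T) && decide (k = 0))) := by
      rw [testBit_shift_block]
      simp only [mark, testBit_tab _ hk]
      by_cases ht : t = 0 <;> simp [ht, hLk]
    have hfull : full.testBit (L * t + k) = decide (t < T) := by
      simp only [full, testBit_tab _ hk, Bool.and_true]
    have hzfull : (2 ^ L * full).testBit (L * t + k) =
        (!decide (t = 0) && decide (t - 1 < T)) := by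
      rw [testBit_shift_block]
      simp only [full, testBit_tab _ hk]
      by_cases ht : t = 0 <;> simp [ht, hLk]
    have hev : ∀ a, (ev a).testBit (L * t + k) =
        (decide (t < T) && (decide (k = 0) && decide (e t = a))) := fun a => testBit_tab _ hk
    have hfill : ∀ a, (fill a).testBit (L * t + k) = (decide (t < T) && decide (e t = a)) :=
      fun a => testBit_tab _ hk
    have hreg : ∀ p, (reg p).testBit (L * t + k) = (C t p).testBit k := fun p =>
      (testBit_tab _ hk).trans (hCt t p k)
    have hznxt : ∀ p, (2 ^ L * nxt p).testBit (L * t + k) =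
        (!decide (t = 0) && (C t p).testBit k) := by
      intro p
      rw [testBit_shift_block]
      simp only [nxt, testBit_tab _ hk, hCt']
      rcases t with _ | t <;> simp [hLk]
    constructor
    case one =>
      change Nat.testBit 1 (L * t + k) =
        (mark.testBit (L * t + k) && !(2 ^ L * mark).testBit (L * t + k))
      rw [testBit_one, hmark, hzmark]
      rcases t with _ | t
      · simp [hT]
      · have h1 : L * (t + 1) + k ≠ 0 := by positivity
        by_cases ht : t + 1 < T
        · have : t < T := by omega
          rw [decide_eq_false h1]
          by_cases hk0 : k = 0 <;> simp [this, hk0]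
        · rw [decide_eq_false h1]
          simp [ht]
    case full =>
      change full.testBit (L * t + k) = (mark.testBit (L * t + k) ||
        ((2 * full).testBit (L * t + k) && !(2 ^ L * mark).testBit (L * t + k)))
      rw [hfull, hmark, hzmark, testBit_double_block hL1]
      simp only [full, testBit_tab _ hk1, testBit_tab _ hL1']
      by_cases hk0 : k = 0 <;> by_cases ht : t = 0 <;> by_cases ht' : t < T <;>
        by_cases ht'' : t - 1 < T <;> simp [hk0, ht, ht', ht'']
    case inp =>
      intro hb
      change Nat.testBit n (L * t + k) = true at hb
      have hn : n = C 0 p₀ := by rw [h0]; simp [initTokens]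
      have ht : t = 0 := by
        by_contra ht
        have : L ≤ L * t := Nat.le_mul_of_pos_right _ (Nat.pos_of_ne_zero ht)
        rw [hn, hC 0 p₀ _ (by omega)] at hb
        cases hb
      exact ⟨hfull.trans (by simp [ht, hT]), hzfull.trans (by simp [ht])⟩
    case mark_of_ev =>
      intro a ha
      have ha' := (hev a).symm.trans ha
      simp only [Bool.and_eq_true, decide_eq_true_eq] at ha'
      exact hmark.trans (by simp [ha'.1, ha'.2.1])
    case exists_ev =>
      intro ha
      have ha' := hmark.symm.trans ha
      simp only [Bool.and_eq_true, decide_eq_true_eq] at ha'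
      exact ⟨e t, (hev _).trans (by simp [ha'.1, ha'.2])⟩
    case ev_unique =>
      intro a b ha hb
      have ha' := (hev a).symm.trans ha
      have hb' := (hev b).symm.trans hb
      simp only [Bool.and_eq_true, decide_eq_true_eq] at ha' hb'
      exact ha'.2.2.symm.trans hb'.2.2
    case fill =>
      intro a
      change (fill a).testBit (L * t + k) = ((ev a).testBit (L * t + k) ||
        ((2 * fill a).testBit (L * t + k) && !mark.testBit (L * t + k) &&
          !(2 ^ L * mark).testBit (L * t + k)))
      rw [hfill, hev, hmark, hzmark, testBit_double_block hL1]
      simp only [fill, testBit_tab _ hk1, testBit_tab _ hL1']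
      by_cases hk0 : k = 0 <;> by_cases ht : t = 0 <;> by_cases ht' : t < T <;>
        by_cases ht'' : t - 1 < T <;> simp [hk0, ht, ht', ht'']
    case reg_full =>
      intro p hb
      have hb' := (hreg p).symm.trans hb
      rw [← hCt, Bool.and_eq_true] at hb'
      exact hfull.trans hb'.1
    case dreg =>
      intro p hb
      change (2 * reg p).testBit (L * t + k) = true at hb
      have hk0 : k ≠ 0 := by
        rintro rfl
        rw [testBit_double_block hL1, if_pos rfl] at hb
        simp only [reg, testBit_tab _ hL1', hC _ _ (L - 1) (by omega), Bool.and_false] at hb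
        cases hb
      exact ⟨hmark.trans (by simp [hk0]), hzmark.trans (by simp [hk0])⟩
    case reg =>
      intro p
      rw [hinit]
      change (reg p).testBit (L * t + k) = ((2 ^ L * nxt p).testBit (L * t + k) ^^ _)
      rw [hreg, hznxt]
      by_cases ht : t = 0 <;> simp [ht]
    case init =>
      intro p
      rw [hinit]
      change ((2 ^ L * nxt p).testBit (L * t + k) && _) = false
      rw [hznxt]
      by_cases ht : t = 0 <;> simp [ht]
    case inc =>
      intro p
      change (inc p).testBit (L * t + k) = true ↔ ∃ a, (ev a).testBit (L * t + k) = true ∧ _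
      simp only [inc, testBit_tab _ hk, hev, Bool.and_eq_true, decide_eq_true_eq]
      constructor
      · rintro ⟨h1, h2, h3⟩
        exact ⟨_, ⟨h1, h2, rfl⟩, h3⟩
      · rintro ⟨_, ⟨h1, h2, rfl⟩, h3⟩
        exact ⟨h1, h2, h3⟩
    case dec =>
      intro p
      change (dec p).testBit (L * t + k) = true ↔ ∃ a, (ev a).testBit (L * t + k) = true ∧ _
      simp only [dec, testBit_tab _ hk, hev, Bool.and_eq_true, decide_eq_true_eq]
      constructor
      · rintro ⟨h1, h2, h3⟩
        exact ⟨_, ⟨h1, h2, rfl⟩, h3⟩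
      · rintro ⟨_, ⟨h1, h2, rfl⟩, h3⟩
        exact ⟨h1, h2, h3⟩
    case maj₁ => exact fun p => testBit_majorityNat _ _ _ _
    case maj₂ => exact fun p => testBit_majorityNat _ _ _ _
    case sum =>
      intro p
      have := congrArg (fun a => a.testBit (L * t + k))
        ((hcar₁' p).trans ((hsum p).trans (hcar₂' p).symm))
      simpa only [Nat.testBit_xor] using this
    case inh =>
      intro a p hap hb
      have hb' := (hfill a).symm.trans hb
      simp only [Bool.and_eq_true, decide_eq_true_eq] at hb'
      obtain ⟨ht, rfl⟩ := hb'
      exact (hreg p).trans (by rw [(hstep t ht).1 p hap, Nat.zero_testBit])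
  · rintro x y hxy
    cases x <;> cases hxy <;> first | rfl | exact hcar₁ _ | exact hcar₂ _
  · rintro x y hxy
    cases x <;> cases hxy <;> rfl

end

/-! ### The theorem for operations that decode tuples -/

/-- A common scale `2 ^ s` does not affect a condition on the bits of a tuple that allows all bits
to be zero. -/
theorem forall_bits_two_pow_mul {ι : Type*} {B : (ι → Bool) → Prop} (hB : B fun _ => false) (s : ℕ)
    (v : ι → ℕ) : (∀ i, B fun x => (2 ^ s * v x).testBit i) ↔ ∀ i, B fun x => (v x).testBit i := by
  constructor
  · intro h i
    have := h (s + i)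
    simpa [Nat.testBit_two_pow_mul] using this
  · intro h i
    simp only [Nat.testBit_two_pow_mul]
    by_cases hi : s ≤ i
    · simpa [hi] using h (i - s)
    · simpa [hi] using hB

theorem DecodesTuples.recognizes {op : Set Operation} (hd : DecodesTuples op)
    (hb : boolOps ⊆ op) (hi : incOp ∈ op) {S : Set ℕ} (hS : REPred fun n => n ∈ S) :
    ∃ T : ℕ, RecognizesInTime op S (fun _ => T) := by
  classical
  obtain ⟨P, E, hP, hE, _, net, p₀, p₁, hp, hnet⟩ := exists_net hS
  have hinit : ∀ n, (Pi.single p₀ n + Pi.single p₁ 1 : P → ℕ) = initTokens p₀ p₁ n := by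
    intro n
    funext p
    by_cases h0 : p = p₀
    · subst h0; simp [initTokens, hp]
    · by_cases h1 : p = p₁
      · subst h1; simp [initTokens, h0]
      · simp [initTokens, h0, h1]
  cases nonempty_fintype P
  cases nonempty_fintype E
  let σ := Fintype.equivFin (Var P E)
  obtain ⟨s, L, w, ok, hn, h1, hw, hdouble, hshift, hL, hdvd, hdec⟩ := hd (Fintype.card (Var P E))
  have hval : ∀ α, ∃ v : Var P E → ℕ, ∀ x, w (σ x) α = 2 ^ s α * v x :=
    fun α => ⟨fun x => (hdvd α _ (σ x).2).choose, fun x => (hdvd α _ (σ x).2).choose_spec⟩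
  have hpos : ∀ α, 0 < 2 ^ s α := fun α => by positivity
  have test : StraightlineTest op fun n α =>
      ((w (σ .inp) α = 2 ^ s α * n ∧ w (σ .one) α = 2 ^ s α) ∧
        ∀ i, net.BitsOK p₀ p₁ fun x => (w (σ x) α).testBit i) ∧
      (∀ x y : Var P E, x.doubled = some y → w (σ y) α = 2 * w (σ x) α) ∧
      (∀ x y : Var P E, x.shifted = some y → ok α ∧ w (σ y) α = 2 ^ L α * w (σ x) α) := by
    refine .and hb (.and hb (.and hb (.eq hb (hw _) hn) (.eq hb (hw _) h1))
      (.bits hb (net.bitsOK_false p₀ p₁) fun x => hw (σ x))) (.and hb ?_ ?_)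
    all_goals refine .forall hb fun x => .forall hb fun y => ?_
    · by_cases hxy : x.doubled = some y
      · simpa only [hxy, forall_const] using hdouble (σ x) (σ y)
      · exact (StraightlineTest.eq hb .zero .zero).congr fun n α => by simp [hxy]
    · by_cases hxy : x.shifted = some y
      · simpa only [hxy, forall_const] using hshift (σ x) (σ y)
      · exact (StraightlineTest.eq hb .zero .zero).congr fun n α => by simp [hxy]
  refine test.recognizes hb hi fun n => ?_
  rw [hnet, hinit]
  constructor
  · intro h
    obtain ⟨L₀, hv⟩ := net.exists_tableau hp h
    obtain ⟨l, hl, hcode⟩ := hdec L₀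
    obtain ⟨v, hv, hv1, hvn⟩ := hv l hl
    obtain ⟨α, hok, rfl, hα⟩ := hcode fun j => if h : j < _ then v (σ.symm ⟨j, h⟩) else 0
    have hx : ∀ x, w (σ x) α = 2 ^ s α * v x := fun x => by simpa using hα (σ x) (σ x).2
    refine ⟨α, ?_⟩
    simp only [hx]
    refine ⟨⟨⟨by rw [hvn], by rw [hv1, mul_one]⟩,
      (forall_bits_two_pow_mul (net.bitsOK_false p₀ p₁) _ _).mpr hv.bits⟩, fun x y hxy => ?_,
      fun x y hxy => ⟨hok, ?_⟩⟩
    · rw [hv.double x y hxy]; ring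
    · rw [hv.shift x y hxy]; ring
  · rintro ⟨α, ⟨⟨h2, h3⟩, h4⟩, h5, h6⟩
    obtain ⟨v, hx⟩ := hval α
    simp only [hx] at h2 h3 h4 h5 h6
    have hvn : v .inp = n := Nat.eq_of_mul_eq_mul_left (hpos α) h2
    have hv1 : v .one = 1 := Nat.eq_of_mul_eq_mul_left (hpos α) (h3.trans (mul_one _).symm)
    have htab : net.IsTableau p₀ p₁ (L α) v := by
      refine ⟨(forall_bits_two_pow_mul (net.bitsOK_false p₀ p₁) _ _).mp h4, fun x y hxy => ?_,
        fun x y hxy => ?_⟩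
      · refine Nat.eq_of_mul_eq_mul_left (hpos α) ((h5 x y hxy).trans ?_)
        ring
      · refine Nat.eq_of_mul_eq_mul_left (hpos α) ((h6 x y hxy).2.trans ?_)
        ring
    rw [← hvn]
    exact htab.reach hv1 (hL α)

end NRAM

theorem theorem6 (op : Set NRAM.Operation)
    (hop : {NRAM.shiftLeftOp, NRAM.incOp} ∪ NRAM.boolOps ⊆ op ∨
      {NRAM.shiftRightOp, NRAM.incOp} ∪ NRAM.boolOps ⊆ op ∨
      {NRAM.exactDivOp, NRAM.incOp} ∪ NRAM.boolOps ⊆ op ∨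
      {NRAM.mulOp, NRAM.incOp} ∪ NRAM.boolOps ⊆ op)
    (S : Set ℕ) (hS : REPred fun n : ℕ => n ∈ S) :
    ∃ T : ℕ, NRAM.RecognizesInTime op S (fun _ => T) := by
  have split : ∀ o : NRAM.Operation, {o, NRAM.incOp} ∪ NRAM.boolOps ⊆ op →
      o ∈ op ∧ NRAM.incOp ∈ op ∧ NRAM.boolOps ⊆ op := fun o h =>
    ⟨h (.inl (.inl rfl)), h (.inl (.inr rfl)), fun x hx => h (.inr hx)⟩
  rcases hop with h | h | h | h <;> obtain ⟨ho, hi, hb⟩ := split _ h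
  · exact (NRAM.decodesTuples_shiftLeft hb hi ho).recognizes hb hi hS
  · exact (NRAM.decodesTuples_shiftRight hb hi ho).recognizes hb hi hS
  · exact (NRAM.decodesTuples_exactDiv hb hi ho).recognizes hb hi hS
  · exact (NRAM.decodesTuples_mul hb hi ho).recognizes hb hi hS
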